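/- **Setting.** Call an open set $U\subseteq\mathbb R^2$ a simple domain if its projection to the $x$-axis and all its sections $\{y:(x,y)\in U\}$ are intervals (possibly empty). Fix a filter $\mathcal F$ of subsets of $\mathbb R^2$ that has a base of nonempty simple domains (for example, the neighbourhoods of a point, or the supersets of one simple domain). "Function of $(x,y)$" means a real $C^\infty$ function defined on some open set belonging to $\mathcal F$, two such functions being identified if they agree on a member of $\mathcal F$. A function of $x$ is a function of $(x,y)$ that on some open $U\in\mathcal F$ has the form $g(x)$ with $g$ a $C^\infty$ function on the projection of $U$. Let $K$ be a differential field of such functions: a subring, containing $1$, of the ring of functions of $(x,y)$, in which every nonzero element has an inverse and which is closed under $\partial/\partial x$ and $\partial/\partial y$. Let $K_x\subseteq K$ be the set of elements of $K$ that are functions of $x$. Operators are linear ordinary differential operators $a_0+a_1D+\dots+a_nD^n$, $D=\partial/\partial x$, multiplied by composition; $L(x,y)$ denotes an operator with coefficients in $K$, and $R(x)$ one with coefficients in $K_x$. A multiintegral $\mathcal J=(L_1,\dots,L_k)$ is a row $\overline L$ of operators $L_i(x,y)$. Its function stock is $$Z(\mathcal J)=\{L_1\varphi_1+\dots+L_k\varphi_k:\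 \varphi_1,\dots,\varphi_k \text{ arbitrary } C^\infty \text{ functions of } x\}.$$ A matrix $\widehat R(x)=(R_{ij}(x))$ is invertible if $\widehat R\widehat S=1$ and $\widehat S\widehat R=1$ for some matrix $\widehat S(x)$ of operators with coefficients in $K_x$. The multiintegral $\mathcal J$ is operator-reducible if $\overline L=\overline N\,\widehat R(x)$ for some row $\overline N=(N_1(x,y),\dots,N_q(x,y))$ with $q\le k$ and some non-invertible $q\times k$ matrix $\widehat R(x)$; otherwise it is operator-irreducible. The rank of $\widehat R(x)$ is the number of nonzero rows of an echelon matrix obtained from it by transposing two rows and by adding to a row another row multiplied on the left by an operator $T(x)$. (In an echelon matrix the first nonzero entries of the nonzero rows move strictly to the right from row to row, and the zero rows come last.) **Theorem.** Let $\mathcal J_1=(M_1,\dots,M_p)$ and $\mathcal J_2=(L_1,\dots,L_k)$ be multiintegrals, let $\mathcal J_1$ be operator-irreducible, and suppose $Z(\mathcal J_2)\subseteq Z(\mathcal J_1)$. Then $$(L_1,\dots,L_k)=(M_1,\dots,M_p)\,\widehat R(x)$$ for some $p\times k$ matrix $\widehat R(x)$ of operators with coefficients in $K_x$. Moreover, for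 every such matrix $\widehat R(x)$, its rank equals the number $p$ of its rows if and only if $Z(\mathcal J_1)=Z(\mathcal J_2)$. -/

import Mathlib

open scoped ContDiff

namespace Euler

/-! ### Domains and smooth functions of `(x, y)` -/

/-- An open set of the plane of the form `{(x, y) | x ∈ I, y ∈ I_x}` with intervals `I` and `I_x`. -/
def IsSimpleDomain (U : Set (ℝ × ℝ)) : Prop :=
  IsOpen U ∧ (Prod.fst '' U).OrdConnected ∧ ∀ x : ℝ, {y : ℝ | (x, y) ∈ U}.OrdConnected

/-- The possible common domains of definition: a filter on the plane which has a base of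
nonempty simple domains.  Functions are considered on a member of the filter, and may be restricted
to a smaller member.  Examples: the neighbourhoods of a point; the supersets of one
simple domain. -/
structure DomainFilter where
  toFilter : Filter (ℝ × ℝ)
  neBot : toFilter.NeBot
  exists_domain : ∀ s ∈ toFilter, ∃ U ∈ toFilter, U ⊆ s ∧ IsSimpleDomain U

variable {F : DomainFilter}

/-- `f` is (the class of) a function which is smooth on some domain of the filter. -/
def IsSmooth (f : Filter.Germ F.toFilter ℝ) : Prop :=
  ∃ u : ℝ × ℝ → ℝ, ∃ U ∈ F.toFilter, IsOpen U ∧ ContDiffOn ℝ ∞ u U ∧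
    f = (u : Filter.Germ F.toFilter ℝ)

/-- The ring of smooth real functions of `(x, y)`, each defined on some domain of the filter; two
of them are identified if they agree on some smaller domain of the filter. -/
def Fun (F : DomainFilter) : Subring (Filter.Germ F.toFilter ℝ) where
  carrier := {f | IsSmooth f}
  mul_mem' := by
    rintro _ _ ⟨u, U, hU, oU, cu, rfl⟩ ⟨v, V, hV, oV, cv, rfl⟩
    exact ⟨u * v, U ∩ V, Filter.inter_mem hU hV, oU.inter oV,
      (cu.mono Set.inter_subset_left).mul (cv.mono Set.inter_subset_right), rfl⟩
  one_mem' := ⟨1, Set.univ, Filter.univ_mem, isOpen_univ,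
    contDiffOn_const (c := (1 : ℝ)), rfl⟩
  add_mem' := by
    rintro _ _ ⟨u, U, hU, oU, cu, rfl⟩ ⟨v, V, hV, oV, cv, rfl⟩
    exact ⟨u + v, U ∩ V, Filter.inter_mem hU hV, oU.inter oV,
      (cu.mono Set.inter_subset_left).add (cv.mono Set.inter_subset_right), rfl⟩
  zero_mem' := ⟨0, Set.univ, Filter.univ_mem, isOpen_univ,
    contDiffOn_const (c := (0 : ℝ)), rfl⟩
  neg_mem' := by
    rintro _ ⟨u, U, hU, oU, cu, rfl⟩
    exact ⟨-u, U, hU, oU, cu.neg, rfl⟩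

/-- Functions which agree on a domain have the same derivatives there. -/
theorem fderiv_eventuallyEq (w : ℝ × ℝ) {u v : ℝ × ℝ → ℝ} (h : u =ᶠ[F.toFilter] v) :
    (fun q => fderiv ℝ u q w) =ᶠ[F.toFilter] fun q => fderiv ℝ v q w := by
  obtain ⟨U, hU, hsub, hd⟩ := F.exists_domain _ h
  refine Filter.mem_of_superset hU fun q hq => ?_
  have : u =ᶠ[nhds q] v := Filter.mem_of_superset (hd.1.mem_nhds hq) hsub
  change fderiv ℝ u q w = fderiv ℝ v q w
  rw [this.fderiv_eq]

/-- The derivative in the direction `w`. -/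
noncomputable def dirDeriv (w : ℝ × ℝ) (f : Filter.Germ F.toFilter ℝ) :
    Filter.Germ F.toFilter ℝ :=
  f.map' (fun u q => fderiv ℝ u q w) fun _ _ h => fderiv_eventuallyEq w h

theorem IsSmooth.dirDeriv (w : ℝ × ℝ) {f : Filter.Germ F.toFilter ℝ} (hf : IsSmooth f) :
    IsSmooth (dirDeriv w f) := by
  obtain ⟨u, U, hU, oU, cu, rfl⟩ := hf
  exact ⟨fun q => fderiv ℝ u q w, U, hU, oU,
    (cu.fderiv_of_isOpen oU (by simp)).clm_apply contDiffOn_const, rfl⟩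

theorem dirDeriv_add (w : ℝ × ℝ) {f g : Filter.Germ F.toFilter ℝ} (hf : IsSmooth f)
    (hg : IsSmooth g) : dirDeriv w (f + g) = dirDeriv w f + dirDeriv w g := by
  obtain ⟨u, U, hU, oU, cu, rfl⟩ := hf
  obtain ⟨v, V, hV, oV, cv, rfl⟩ := hg
  refine Filter.Germ.coe_eq.2 (Filter.mem_of_superset (Filter.inter_mem hU hV) fun q hq => ?_)
  have h1 : DifferentiableAt ℝ u q :=
    (cu.contDiffAt (oU.mem_nhds hq.1)).differentiableAt (by simp)
  have h2 : DifferentiableAt ℝ v q :=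
    (cv.contDiffAt (oV.mem_nhds hq.2)).differentiableAt (by simp)
  change fderiv ℝ (u + v) q w = fderiv ℝ u q w + fderiv ℝ v q w
  rw [fderiv_add h1 h2]
  rfl

/-- The derivative in the direction `w`, as an additive map on smooth functions. -/
noncomputable def pderiv (w : ℝ × ℝ) : AddMonoid.End (Fun F) :=
  AddMonoidHom.mk' (fun f => (⟨dirDeriv w f.1, f.2.dirDeriv w⟩ : Fun F))
    fun f g => Subtype.ext (dirDeriv_add w f.2 g.2)

/-- `∂/∂x`. -/
noncomputable def dx : AddMonoid.End (Fun F) := pderiv (1, 0)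

/-- `∂/∂y`. -/
noncomputable def dy : AddMonoid.End (Fun F) := pderiv (0, 1)

/-- `f` is a smooth function of the variable `x` alone. -/
def OnlyX (f : Fun F) : Prop :=
  ∃ g : ℝ → ℝ, ∃ U ∈ F.toFilter, IsOpen U ∧ ContDiffOn ℝ ∞ g (Prod.fst '' U) ∧
    (f : Filter.Germ F.toFilter ℝ) = ((fun q => g q.1 : ℝ × ℝ → ℝ) : Filter.Germ F.toFilter ℝ)

/-- A differential field of functions in the plane. -/
structure DiffField (F : DomainFilter) where
  toSubring : Subring (Fun F)
  exists_inv : ∀ f ∈ toSubring, f ≠ 0 → ∃ g ∈ toSubring, f * g = 1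
  dx_mem : ∀ f ∈ toSubring, dx f ∈ toSubring
  dy_mem : ∀ f ∈ toSubring, dy f ∈ toSubring

/-! ### Linear ordinary differential operators in `x` -/

/-- `T` is an operator `a₀ + a₁ D + ⋯ + aₙ Dⁿ`, `D = ∂/∂x`, with coefficients in `C`.
Operators are maps on smooth functions of `(x, y)`; their product is the composition. -/
def IsLODO (C : Set (Fun F)) (T : AddMonoid.End (Fun F)) : Prop :=
  ∃ (n : ℕ) (a : ℕ → Fun F), (∀ i, a i ∈ C) ∧
    T = ∑ i ∈ Finset.range (n + 1), AddMonoid.End.mulLeft (a i) * dx ^ i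

namespace DiffField

variable (K : DiffField F)

/-- Operators `L(x, y)`, with coefficients in the differential field. -/
def IsOp (T : AddMonoid.End (Fun F)) : Prop :=
  IsLODO {f | f ∈ K.toSubring} T

/-- Operators `R(x)`, with coefficients in the differential field that depend on `x` only. -/
def IsOpX (T : AddMonoid.End (Fun F)) : Prop :=
  IsLODO {f | f ∈ K.toSubring ∧ OnlyX f} T

/-- Matrices `R̂(x)` of operators whose coefficients depend on `x` only. -/
def IsMatX {m n : ℕ} (R : Matrix (Fin m) (Fin n) (AddMonoid.End (Fun F))) : Prop :=
  ∀ i j, K.IsOpX (R i j)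

/-- `R̂(x)` has a two-sided inverse operator matrix `Ŝ(x)`. -/
def IsInvertible {m n : ℕ} (R : Matrix (Fin m) (Fin n) (AddMonoid.End (Fun F))) : Prop :=
  ∃ S : Matrix (Fin n) (Fin m) (AddMonoid.End (Fun F)), K.IsMatX S ∧ R * S = 1 ∧ S * R = 1

/-- The multiintegral with operator row `L` is operator-reducible: `L̄ = M̄ R̂(x)` with a
non-invertible matrix `R̂(x)` that has at most as many rows as columns. -/
def OperatorReducible {k : ℕ} (L : Fin k → AddMonoid.End (Fun F)) : Prop :=
  ∃ p ≤ k, ∃ (M : Fin p → AddMonoid.End (Fun F))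
    (R : Matrix (Fin p) (Fin k) (AddMonoid.End (Fun F))),
    (∀ i, K.IsOp (M i)) ∧ K.IsMatX R ∧ ¬ K.IsInvertible R ∧ L = Matrix.vecMul M R

/-- The two elementary row operations on operator matrices: transposition of two rows, and
addition to a row of another row multiplied on the left with an operator `T(x)`. -/
inductive RowStep {m n : ℕ} :
    Matrix (Fin m) (Fin n) (AddMonoid.End (Fun F)) →
      Matrix (Fin m) (Fin n) (AddMonoid.End (Fun F)) → Prop
  | swap (R : Matrix (Fin m) (Fin n) (AddMonoid.End (Fun F))) (i j : Fin m) :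
      RowStep R (R.submatrix (Equiv.swap i j) id)
  | add (R : Matrix (Fin m) (Fin n) (AddMonoid.End (Fun F))) (i j : Fin m) (_ : i ≠ j)
      (T : AddMonoid.End (Fun F)) (_ : K.IsOpX T) :
      RowStep R (R.updateRow i fun c => R i c + T * R j c)

end DiffField

/-- Echelon matrices: the first nonzero entry of a row lies strictly to the right of the first
nonzero entry of each earlier row, and the zero rows come last. -/
def IsEchelon {m n : ℕ} (R : Matrix (Fin m) (Fin n) (AddMonoid.End (Fun F))) : Prop :=
  ∀ i i' : Fin m, i < i' → ∀ c', R i' c' ≠ 0 → ∃ c < c', R i c ≠ 0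

/-- `R̂(x)` has rank `r`: elementary row operations bring it to an echelon matrix with exactly `r`
nonzero rows. -/
def DiffField.HasRank (K : DiffField F) {m n : ℕ}
    (R : Matrix (Fin m) (Fin n) (AddMonoid.End (Fun F))) (r : ℕ) : Prop :=
  ∃ A : Matrix (Fin m) (Fin n) (AddMonoid.End (Fun F)),
    Relation.ReflTransGen K.RowStep R A ∧ IsEchelon A ∧ {i | A i ≠ 0}.ncard = r

/-- The function stock of the multiintegral `L₁ φ₁(x) + ⋯ + L_k φ_k(x)`: all functions obtained
from smooth functions `φ₁, …, φ_k` of `x`. -/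
def stock {k : ℕ} (L : Fin k → AddMonoid.End (Fun F)) : Set (Fun F) :=
  {f | ∃ φ : Fin k → Fun F, (∀ i, OnlyX (φ i)) ∧ f = ∑ i, L i (φ i)}

end Euler

/-! The coefficients of all the `M i` and `L j` span a finite-dimensional space over the field
$K_x$. Expanding them in a basis $e_\alpha\in K$ of it gives $\overline M=\overline E\,\widehat
Q(x)$ and $\overline L=\overline E\,\widehat P(x)$, where $\overline E$ is the row of
multiplications by the $e_\alpha$ (`exists_common_factor`). A Wronskian-type argument with
$\partial/\partial y$ (`onlyX_independent`) shows that the $e_\alpha$ are independent even over all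
functions of $x$, so $\overline E$ is injective on columns of functions of $x$. Irreducibility of
$\overline M$ yields a left inverse $\widehat S$ of $\widehat Q$
(`exists_left_inverse_of_irreducible`), hence $\overline M$ is injective on such columns too.

If $Z(\mathcal J_2)\subseteq Z(\mathcal J_1)$, then for every $\varphi$ there is $\psi$ with
$\widehat P\varphi=\widehat Q\psi$. Applying $\widehat S$ gives $\psi=\widehat S\widehat P\varphi$,
so $\widehat P$ and $\widehat Q\widehat S\widehat P$ agree on functions of $x$. An operator is
determined by its values there (`eq_zero_of_forall_onlyX`), so $\widehat P=\widehat Q\widehat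
S\widehat P$ and $\widehat R=\widehat S\widehat P$ works.

Since $\overline M$ is injective, the stocks coincide exactly when $\widehat R$ is onto columns of
functions of $x$. By `hasRank_iff_ontoX` this is full row rank: an echelon matrix without zero rows
is onto by back substitution, because a nonzero scalar operator over $K_x$ is onto (global
solvability of linear equations), while a zero row obstructs surjectivity. -/

namespace Euler

variable {F : DomainFilter}

/-! ### Partial derivatives and functions of $x$ alone. -/

theorem pderiv_mul (w : ℝ × ℝ) (f g : Fun F) :
    pderiv w (f * g) = f * pderiv w g + pderiv w f * g := by
  obtain ⟨f, u, U, hU, oU, cu, rfl⟩ := f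
  obtain ⟨g, v, V, hV, oV, cv, rfl⟩ := g
  refine Subtype.ext (Filter.Germ.coe_eq.2
    (Filter.mem_of_superset (Filter.inter_mem hU hV) fun q hq => ?_))
  have h1 : DifferentiableAt ℝ u q :=
    (cu.contDiffAt (oU.mem_nhds hq.1)).differentiableAt (by simp)
  have h2 : DifferentiableAt ℝ v q :=
    (cv.contDiffAt (oV.mem_nhds hq.2)).differentiableAt (by simp)
  change fderiv ℝ (u * v) q w = u q * fderiv ℝ v q w + fderiv ℝ u q w * v q
  rw [fderiv_mul h1 h2]
  simp [mul_comm]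

theorem dx_mul (f g : Fun F) : dx (f * g) = f * dx g + dx f * g := pderiv_mul _ f g

theorem dy_mul (f g : Fun F) : dy (f * g) = f * dy g + dy f * g := pderiv_mul _ f g

/-- `f` is represented by `g(x)` on the member `U` of the filter. -/
def RepX (f : Fun F) (g : ℝ → ℝ) : Prop :=
  (f : Filter.Germ F.toFilter ℝ) = ((fun q => g q.1 : ℝ × ℝ → ℝ) : Filter.Germ F.toFilter ℝ)

/-- The function of `(x, y)` given by a function of `x` that is smooth on the projection of a
member of the filter. -/
theorem exists_repX {g : ℝ → ℝ} {U : Set (ℝ × ℝ)} (hU : U ∈ F.toFilter) (oU : IsOpen U)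
    (hg : ContDiffOn ℝ ∞ g (Prod.fst '' U)) : ∃ f : Fun F, OnlyX f ∧ RepX f g :=
  ⟨⟨_, fun q => g q.1, U, hU, oU,
    hg.comp contDiff_fst.contDiffOn fun _ hq => Set.mem_image_of_mem _ hq, rfl⟩,
    ⟨g, U, hU, oU, hg, rfl⟩, rfl⟩

theorem pderiv_repX (w : ℝ × ℝ) {f : Fun F} {g g' : ℝ → ℝ} {U : Set (ℝ × ℝ)}
    (hU : U ∈ F.toFilter) (hf : RepX f g) (hg : ∀ x ∈ Prod.fst '' U, HasDerivAt g (g' x) x) :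
    RepX (pderiv w f) fun x => w.1 * g' x := by
  obtain ⟨f, hs⟩ := f
  change f = _ at hf
  subst hf
  refine Filter.Germ.coe_eq.2 (Filter.mem_of_superset hU fun q hq => ?_)
  have h := (hg q.1 (Set.mem_image_of_mem _ hq)).comp_hasFDerivAt q
    (hasFDerivAt_fst (𝕜 := ℝ) (p := q))
  change fderiv ℝ (fun q : ℝ × ℝ => g q.1) q w = w.1 * g' q.1
  have h' : HasFDerivAt (fun q : ℝ × ℝ => g q.1) _ q := h
  rw [h'.fderiv]
  simp [mul_comm]

theorem RepX.dx {f : Fun F} {g g' : ℝ → ℝ} {U : Set (ℝ × ℝ)} (hU : U ∈ F.toFilter)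
    (hf : RepX f g) (hg : ∀ x ∈ Prod.fst '' U, HasDerivAt g (g' x) x) : RepX (dx f) g' := by
  have h := pderiv_repX (1, 0) hU hf hg
  simp only [one_mul] at h
  exact h

theorem RepX.eq {f f' : Fun F} {g g' : ℝ → ℝ} {U : Set (ℝ × ℝ)} (hU : U ∈ F.toFilter)
    (hf : RepX f g) (hf' : RepX f' g') (h : ∀ x ∈ Prod.fst '' U, g x = g' x) : f = f' := by
  refine Subtype.ext (hf.trans (Eq.trans ?_ hf'.symm))
  exact Filter.Germ.coe_eq.2
    (Filter.mem_of_superset hU fun q hq => h _ (Set.mem_image_of_mem _ hq))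

theorem RepX.add {f f' : Fun F} {g g' : ℝ → ℝ} (hf : RepX f g) (hf' : RepX f' g') :
    RepX (f + f') fun x => g x + g' x := by
  unfold RepX at *
  rw [Subring.coe_add, hf, hf']
  rfl

theorem RepX.mul {f f' : Fun F} {g g' : ℝ → ℝ} (hf : RepX f g) (hf' : RepX f' g') :
    RepX (f * f') fun x => g x * g' x := by
  unfold RepX at *
  rw [Subring.coe_mul, hf, hf']
  rfl

theorem RepX.zero : RepX (0 : Fun F) fun _ => 0 := rfl

theorem RepX.sum {ι : Type*} (s : Finset ι) {f : ι → Fun F} {g : ι → ℝ → ℝ}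
    (h : ∀ i ∈ s, RepX (f i) (g i)) : RepX (∑ i ∈ s, f i) fun x => ∑ i ∈ s, g i x := by
  classical
  induction s using Finset.induction_on with
  | empty => simpa using RepX.zero
  | insert a s ha ih =>
    simp only [Finset.sum_insert ha]
    exact (h a (Finset.mem_insert_self a s)).add
      (ih fun i hi => h i (Finset.mem_insert_of_mem hi))

theorem hasDerivAt_of_contDiffOn_image_fst {g : ℝ → ℝ} {U : Set (ℝ × ℝ)} (oU : IsOpen U)
    (hg : ContDiffOn ℝ ∞ g (Prod.fst '' U)) (x : ℝ) (hx : x ∈ Prod.fst '' U) :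
    HasDerivAt g (deriv g x) x :=
  ((hg.contDiffAt ((isOpenMap_fst U oU).mem_nhds hx)).differentiableAt (by simp)).hasDerivAt

theorem OnlyX.dx {f : Fun F} (hf : OnlyX f) : OnlyX (dx f) := by
  obtain ⟨g, U, hU, oU, hg, hfg⟩ := hf
  have h : RepX (Euler.dx f) (deriv g) :=
    RepX.dx hU hfg (hasDerivAt_of_contDiffOn_image_fst oU hg)
  exact ⟨deriv g, U, hU, oU, hg.deriv_of_isOpen (isOpenMap_fst U oU) (by simp), h⟩

theorem OnlyX.dy_eq_zero {f : Fun F} (hf : OnlyX f) : dy f = 0 := by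
  obtain ⟨g, U, hU, oU, hg, hfg⟩ := hf
  have h : RepX (Euler.dy f) fun x => (0 : ℝ) * deriv g x :=
    pderiv_repX (0, 1) hU hfg (hasDerivAt_of_contDiffOn_image_fst oU hg)
  exact h.eq hU RepX.zero fun x _ => zero_mul _

/-- On a simple domain, a smooth function with vanishing `∂/∂y` depends on `x` only. -/
theorem onlyX_of_dy_eq_zero {f : Fun F} (hf : dy f = 0) : OnlyX f := by
  obtain ⟨f, u, U₀, hU₀, oU₀, cu, rfl⟩ := f
  have h0 : (fun q => fderiv ℝ u q (0, 1)) =ᶠ[F.toFilter] fun _ => (0 : ℝ) :=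
    Filter.Germ.coe_eq.1 (congrArg Subtype.val hf)
  obtain ⟨U, hU, hsub, oU, -, hsec⟩ := F.exists_domain _ (Filter.inter_mem hU₀ h0)
  have cuU : ContDiffOn ℝ ∞ u U := cu.mono fun q hq => (hsub hq).1
  have hconst : ∀ x y y', (x, y) ∈ U → (x, y') ∈ U → u (x, y) = u (x, y') := by
    intro x y y' hy hy'
    have hd : ∀ z ∈ {z : ℝ | (x, z) ∈ U}, HasDerivAt (fun z => u (x, z)) 0 z := by
      intro z hz
      have h1 : HasFDerivAt u (fderiv ℝ u (x, z)) (x, z) :=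
        ((cuU.contDiffAt (oU.mem_nhds hz)).differentiableAt (by simp)).hasFDerivAt
      have h2 : HasDerivAt (fun z : ℝ => (x, z)) (0, 1) z :=
        (hasDerivAt_const z x).prodMk (hasDerivAt_id z)
      have h3 := h1.comp_hasDerivAt z h2
      have h4 : fderiv ℝ u (x, z) (0, 1) = 0 := (hsub hz).2
      rwa [h4] at h3
    have ho : IsOpen {z : ℝ | (x, z) ∈ U} := oU.preimage (by fun_prop)
    exact ho.is_const_of_deriv_eq_zero (hsec x).isPreconnected
      (fun z hz => (hd z hz).differentiableAt.differentiableWithinAt)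
      (fun z hz => (hd z hz).deriv) hy hy'
  -- `Y` picks a point in each vertical section and need not be continuous. Near `x` the height can
  -- be frozen at `Y x`, since `u` does not depend on the height; this gives smoothness.
  choose! Y hY using fun (x : ℝ) (hx : x ∈ Prod.fst '' U) =>
    show ∃ y, (x, y) ∈ U by obtain ⟨q, hq, rfl⟩ := hx; exact ⟨q.2, hq⟩
  refine ⟨fun x => u (x, Y x), U, hU, oU, fun x hx => ?_, ?_⟩
  · have h1 : ContDiffAt ℝ ∞ (fun z => u (z, Y x)) x :=
      (cuU.contDiffAt (oU.mem_nhds (hY x hx))).comp x (f := fun z : ℝ => (z, Y x))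
        (contDiffAt_id.prodMk contDiffAt_const)
    refine (h1.congr_of_eventuallyEq ?_).contDiffWithinAt
    have ho : IsOpen {z : ℝ | (z, Y x) ∈ U} := oU.preimage (by fun_prop)
    filter_upwards [ho.mem_nhds (hY x hx)] with z hz
    exact hconst z _ _ (hY z ⟨_, hz, rfl⟩) hz
  · exact Filter.Germ.coe_eq.2 (Filter.mem_of_superset hU fun q hq =>
      hconst q.1 q.2 _ hq (hY _ ⟨_, hq, rfl⟩))

theorem onlyX_iff {f : Fun F} : OnlyX f ↔ dy f = 0 := ⟨OnlyX.dy_eq_zero, onlyX_of_dy_eq_zero⟩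

/-- The ring of functions of `x`. -/
def ringX (F : DomainFilter) : Subring (Fun F) where
  carrier := {f | OnlyX f}
  mul_mem' {f g} hf hg := by
    simp only [Set.mem_ofPred_eq, onlyX_iff] at *
    rw [dy_mul, hf, hg, mul_zero, zero_mul, add_zero]
  one_mem' := by
    simp only [Set.mem_ofPred_eq, onlyX_iff]
    simpa using dy_mul (1 : Fun F) 1
  add_mem' {f g} hf hg := by
    simp only [Set.mem_ofPred_eq, onlyX_iff] at *
    rw [map_add, hf, hg, add_zero]
  zero_mem' := by simp only [Set.mem_ofPred_eq, onlyX_iff, map_zero]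
  neg_mem' {f} hf := by
    simp only [Set.mem_ofPred_eq, onlyX_iff] at *
    rw [map_neg, hf, neg_zero]

/-- There are functions of `x` with `t₀ = 1`, `t₀' = 0`, `t_{j+1}' = t_j`, namely `x ^ j / j!`. -/
theorem exists_divided_powers (F : DomainFilter) :
    ∃ t : ℕ → Fun F, (∀ j, OnlyX (t j)) ∧ t 0 = 1 ∧ dx (t 0) = 0 ∧ ∀ j, dx (t (j + 1)) = t j := by
  have h : ∀ j : ℕ, ∃ f : Fun F, OnlyX f ∧ RepX f fun x => x ^ j / j.factorial := fun j =>
    exists_repX Filter.univ_mem isOpen_univ (by fun_prop)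
  choose t ht ht' using h
  have h1 : t 0 = 1 := RepX.eq Filter.univ_mem (ht' 0) (show RepX 1 fun _ => 1 from rfl) (by simp)
  refine ⟨t, ht, h1, ?_, fun j => ?_⟩
  · rw [h1]
    simpa using dx_mul (1 : Fun F) 1
  · refine RepX.eq Filter.univ_mem (RepX.dx (g' := fun x => x ^ j / j.factorial)
      Filter.univ_mem (ht' (j + 1)) fun x _ => ?_) (ht' j) fun _ _ => rfl
    refine ((hasDerivAt_pow (j + 1) x).div_const ((j + 1).factorial : ℝ)).congr_deriv ?_
    rw [Nat.factorial_succ]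
    push_cast
    field_simp

/-- Finitely many functions of `x` are smooth on the projection of a common simple domain. -/
theorem exists_common_repX {ι : Type*} [Finite ι] (f : ι → Fun F) (hf : ∀ i, OnlyX (f i)) :
    ∃ g : ι → ℝ → ℝ, ∃ U ∈ F.toFilter, IsOpen U ∧ U.Nonempty ∧ (Prod.fst '' U).OrdConnected ∧
      (∀ i, ContDiffOn ℝ ∞ (g i) (Prod.fst '' U)) ∧ ∀ i, RepX (f i) (g i) := by
  choose g V hV oV hg hfg using hf
  obtain ⟨U, hU, hsub, oU, hc, -⟩ := F.exists_domain _ (Filter.iInter_mem.2 hV)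
  have := F.neBot
  exact ⟨g, U, hU, oU, Filter.nonempty_of_mem hU, hc, fun i => (hg i).mono
    (Set.image_mono (hsub.trans (Set.iInter_subset V i))), hfg⟩

theorem end_mul_apply {G : Type*} [AddCommMonoid G] (S T : AddMonoid.End G) (f : G) :
    (S * T) f = S (T f) := rfl

theorem end_add_apply {G : Type*} [AddCommMonoid G] (S T : AddMonoid.End G) (f : G) :
    (S + T) f = S f + T f := rfl

theorem end_sum_apply {G ι : Type*} [AddCommMonoid G] (s : Finset ι) (T : ι → AddMonoid.End G)
    (f : G) : (∑ i ∈ s, T i) f = ∑ i ∈ s, T i f := by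
  classical
  induction s using Finset.induction_on with
  | empty => rfl
  | insert a s ha ih => rw [Finset.sum_insert ha, Finset.sum_insert ha, end_add_apply, ih]

/-! ### Global solutions of linear differential equations. -/

section LinearODE

variable {E : Type*} [NormedAddCommGroup E] [NormedSpace ℝ E]

/-- Bootstrapping: if $v$ is $C^n$, then so is $v'=Av+b$, hence $v$ is $C^{n+1}$. -/
theorem contDiffOn_of_linearODE {I : Set ℝ} (oI : IsOpen I) {A : ℝ → E →L[ℝ] E} {b v : ℝ → E}
    (hA : ContDiffOn ℝ ∞ A I) (hb : ContDiffOn ℝ ∞ b I)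
    (hv : ∀ t ∈ I, HasDerivAt v (A t (v t) + b t) t) : ContDiffOn ℝ ∞ v I := by
  refine contDiffOn_infty.2 fun n => ?_
  induction n with
  | zero => exact contDiffOn_zero.2 fun t ht => (hv t ht).continuousAt.continuousWithinAt
  | succ n ih =>
    rw [Nat.cast_succ, contDiffOn_succ_iff_deriv_of_isOpen oI]
    refine ⟨fun t ht => (hv t ht).differentiableAt.differentiableWithinAt,
      fun h => absurd h (by simp), ?_⟩
    refine (((contDiffOn_infty.1 hA n).clm_apply ih).add (contDiffOn_infty.1 hb n)).congr
      fun t ht => (hv t ht).deriv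

variable [CompleteSpace E]

theorem hasDerivAt_integral_of_continuousOn {I : Set ℝ} (oI : IsOpen I) (hI : I.OrdConnected)
    {f : ℝ → E} (hf : ContinuousOn f I) {t₀ t : ℝ} (ht₀ : t₀ ∈ I) (ht : t ∈ I) :
    HasDerivAt (fun s => ∫ r in t₀..s, f r) (f t) t :=
  intervalIntegral.integral_hasDerivAt_right
    ((hf.mono (hI.uIcc_subset ht₀ ht)).intervalIntegrable)
    (hf.stronglyMeasurableAtFilter oI t ht) (hf.continuousAt (oI.mem_nhds ht))

/-- The derivatives of the terms of the Picard series of `v' = A v + b`, `v t₀ = 0`. -/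
noncomputable def picardTerm (A : ℝ → E →L[ℝ] E) (b : ℝ → E) (t₀ : ℝ) : ℕ → ℝ → E
  | 0 => b
  | n + 1 => fun t => A t (∫ r in t₀..t, picardTerm A b t₀ n r)

theorem continuousOn_picardTerm {I : Set ℝ} (oI : IsOpen I) (hI : I.OrdConnected)
    {A : ℝ → E →L[ℝ] E} {b : ℝ → E} (hA : ContinuousOn A I) (hb : ContinuousOn b I) {t₀ : ℝ}
    (ht₀ : t₀ ∈ I) (n : ℕ) : ContinuousOn (picardTerm A b t₀ n) I := by
  induction n with
  | zero => exact hb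
  | succ n ih =>
    exact hA.clm_apply fun t ht =>
      (hasDerivAt_integral_of_continuousOn oI hI ih ht₀ ht).continuousAt.continuousWithinAt

/-- Each integration of $|r-t_0|^n$ produces a factor $1/(n+1)$. The resulting exponential majorant
makes the Picard series converge without shrinking the interval. -/
theorem norm_picardTerm_le {I J : Set ℝ} (oI : IsOpen I) (hI : I.OrdConnected)
    {A : ℝ → E →L[ℝ] E} {b : ℝ → E} (hA : ContinuousOn A I) (hb : ContinuousOn b I) {t₀ : ℝ}
    (hJ : J.OrdConnected) (hJI : J ⊆ I) (ht₀ : t₀ ∈ J) {κ C : ℝ}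
    (hκ : ∀ t ∈ J, ‖A t‖ ≤ κ) (hbC : ∀ t ∈ J, ‖b t‖ ≤ C) (n : ℕ) :
    ∀ t ∈ J, ‖picardTerm A b t₀ n t‖ ≤ C * (κ * |t - t₀|) ^ n / n.factorial := by
  have hκ0 : 0 ≤ κ := (norm_nonneg _).trans (hκ t₀ ht₀)
  induction n with
  | zero => simpa [picardTerm] using hbC
  | succ n ih =>
    intro t ht
    have h1 : ‖∫ r in t₀..t, picardTerm A b t₀ n r‖ ≤
        ∫ r in Set.uIoc t₀ t, C * κ ^ n / n.factorial * |r - t₀| ^ n := by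
      refine intervalIntegral.norm_integral_le_integral_norm_uIoc.trans ?_
      refine MeasureTheory.setIntegral_mono_on ?_ ?_ measurableSet_uIoc fun r hr => ?_
      · exact (((continuousOn_picardTerm oI hI hA hb (hJI ht₀) n).mono
          (hI.uIcc_subset (hJI ht₀) (hJI ht))).norm.integrableOn_compact
            isCompact_uIcc).mono_set Set.uIoc_subset_uIcc
      · exact ((by fun_prop : Continuous fun r : ℝ =>
          C * κ ^ n / n.factorial * |r - t₀| ^ n).continuousOn.integrableOn_compact
            isCompact_uIcc).mono_set Set.uIoc_subset_uIcc
      · refine (ih r (hJ.uIcc_subset ht₀ ht (Set.uIoc_subset_uIcc hr))).trans_eq ?_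
        rw [mul_pow]
        ring
    rw [MeasureTheory.integral_const_mul, integral_pow_abs_sub_uIoc] at h1
    refine ((A t).le_opNorm _).trans ?_
    refine (mul_le_mul (hκ t ht) h1 (norm_nonneg _) hκ0).trans_eq ?_
    rw [Nat.factorial_succ]
    push_cast
    rw [mul_pow, pow_succ κ]
    field_simp

/-- A linear system with continuous coefficients on an open interval has a solution on the whole
interval. -/
theorem exists_solution_linearODE {I : Set ℝ} (oI : IsOpen I) (hI : I.OrdConnected)
    (hne : I.Nonempty) {A : ℝ → E →L[ℝ] E} {b : ℝ → E} (hA : ContinuousOn A I)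
    (hb : ContinuousOn b I) : ∃ v : ℝ → E, ∀ t ∈ I, HasDerivAt v (A t (v t) + b t) t := by
  obtain ⟨t₀, ht₀⟩ := hne
  refine ⟨fun t => ∑' n, ∫ r in t₀..t, picardTerm A b t₀ n r, fun t ht => ?_⟩
  -- Both `t₀` and `t` are enclosed in the interior of a compact interval `[c, d] ⊆ I`, where `A`
  -- and `b` are bounded.
  have hmin : min t₀ t ∈ I := by rcases min_choice t₀ t with h | h <;> rwa [h]
  have hmax : max t₀ t ∈ I := by rcases max_choice t₀ t with h | h <;> rwa [h]
  obtain ⟨ε, hε, hεI⟩ := Metric.isOpen_iff.1 oI _ hmin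
  obtain ⟨δ, hδ, hδI⟩ := Metric.isOpen_iff.1 oI _ hmax
  rw [Real.ball_eq_Ioo] at hεI hδI
  obtain ⟨c, hc, hc'⟩ := exists_between (sub_lt_self (min t₀ t) hε)
  obtain ⟨d, hd', hd⟩ := exists_between (lt_add_of_pos_right (max t₀ t) hδ)
  obtain ⟨hc1, hc2⟩ := lt_min_iff.1 hc'
  obtain ⟨hd1, hd2⟩ := max_lt_iff.1 hd'
  have hJI : Set.Icc c d ⊆ I := hI.out (hεI ⟨hc, hc'.trans (by linarith)⟩)
    (hδI ⟨by linarith, hd⟩)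
  obtain ⟨κ, hκ⟩ := isCompact_Icc.exists_bound_of_continuousOn (hA.mono hJI)
  obtain ⟨C, hC⟩ := isCompact_Icc.exists_bound_of_continuousOn (hb.mono hJI)
  have ht₀J : t₀ ∈ Set.Icc c d := ⟨hc1.le, hd1.le⟩
  have hC0 : 0 ≤ C := (norm_nonneg _).trans (hC t₀ ht₀J)
  have hκ0 : 0 ≤ κ := (norm_nonneg _).trans (hκ t₀ ht₀J)
  have hbound : ∀ n, ∀ s ∈ Set.Icc c d,
      ‖picardTerm A b t₀ n s‖ ≤ C * ((κ * (d - c)) ^ n / n.factorial) := by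
    intro n s hs
    refine (norm_picardTerm_le oI hI hA hb Set.ordConnected_Icc hJI ht₀J hκ hC n s hs).trans ?_
    rw [mul_div_assoc]
    have : |s - t₀| ≤ d - c := abs_le.2 ⟨by linarith [hs.1, hd1], by linarith [hs.2, hc1]⟩
    gcongr
  have hsum : Summable fun n : ℕ => C * ((κ * (d - c)) ^ n / n.factorial) :=
    (Real.summable_pow_div_factorial _).mul_left C
  have hder : ∀ n, ∀ s ∈ Set.Ioo c d, HasDerivAt (fun s => ∫ r in t₀..s, picardTerm A b t₀ n r)
      (picardTerm A b t₀ n s) s := fun n s hs =>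
    hasDerivAt_integral_of_continuousOn oI hI (continuousOn_picardTerm oI hI hA hb ht₀ n) ht₀
      (hJI (Set.Ioo_subset_Icc_self hs))
  have hg0 : Summable fun n : ℕ => ∫ r in t₀..t₀, picardTerm A b t₀ n r := by
    simp
  have hsu : Summable fun n : ℕ => ∫ r in t₀..t, picardTerm A b t₀ n r :=
    summable_of_summable_hasDerivAt_of_isPreconnected hsum isOpen_Ioo isPreconnected_Ioo hder
      (fun n s hs => hbound n s (Set.Ioo_subset_Icc_self hs)) (y₀ := t₀) ⟨hc1, hd1⟩ hg0 ⟨hc2, hd2⟩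
  refine (hasDerivAt_tsum_of_isPreconnected hsum isOpen_Ioo isPreconnected_Ioo hder
    (fun n s hs => hbound n s (Set.Ioo_subset_Icc_self hs)) (y₀ := t₀) ⟨hc1, hd1⟩ hg0
    ⟨hc2, hd2⟩).congr_deriv ?_
  have hs' : Summable fun n : ℕ => picardTerm A b t₀ n t :=
    hsum.of_norm_bounded fun n => hbound n t ⟨hc2.le, hd2.le⟩
  -- The term of index 0 is `b t`; the others sum to `A t` applied to the series itself.
  rw [hs'.tsum_eq_zero_add, add_comm]
  congr 1
  exact ((A t).map_tsum hsu).symm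

end LinearODE

/-- A monic linear equation of order `n + 1` with smooth coefficients on an open interval, as a
system for `v 0, v 1 = (v 0)', …`. -/
theorem exists_companion_solution {I : Set ℝ} (oI : IsOpen I) (hI : I.OrdConnected)
    (hne : I.Nonempty) (n : ℕ) {c : Fin (n + 1) → ℝ → ℝ} {h : ℝ → ℝ}
    (hc : ∀ i, ContDiffOn ℝ ∞ (c i) I) (hh : ContDiffOn ℝ ∞ h I) :
    ∃ v : Fin (n + 1) → ℝ → ℝ, (∀ i, ContDiffOn ℝ ∞ (v i) I) ∧
      (∀ i : Fin n, ∀ t ∈ I, HasDerivAt (v i.castSucc) (v i.succ t) t) ∧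
      ∀ t ∈ I, HasDerivAt (v (Fin.last n)) (∑ i, c i t * v i t + h t) t := by
  let P : Fin (n + 1) → (Fin (n + 1) → ℝ) →L[ℝ] ℝ := fun i => ContinuousLinearMap.proj i
  -- Companion matrix: the last row carries the equation, every other row is $v_j'=v_{j+1}$.
  let row : Fin (n + 1) → ℝ → (Fin (n + 1) → ℝ) →L[ℝ] ℝ := fun i t =>
    Fin.lastCases (motive := fun _ => (Fin (n + 1) → ℝ) →L[ℝ] ℝ) (∑ j, c j t • P j)
      (fun j => P j.succ) i
  let A : ℝ → (Fin (n + 1) → ℝ) →L[ℝ] (Fin (n + 1) → ℝ) := fun t =>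
    ContinuousLinearMap.pi fun i => row i t
  let b : ℝ → Fin (n + 1) → ℝ := fun t => Pi.single (Fin.last n) (h t)
  have hrow : ∀ i, ContDiffOn ℝ ∞ (row i) I := by
    intro i
    induction i using Fin.lastCases with
    | last =>
      simp only [row, Fin.lastCases_last]
      exact ContDiffOn.sum fun j _ => (hc j).smul contDiffOn_const
    | cast j =>
      simp only [row, Fin.lastCases_castSucc]
      exact contDiffOn_const
  have hA : ContDiffOn ℝ ∞ A I := by
    have : A = fun t => ∑ i, (ContinuousLinearMap.single ℝ (fun _ : Fin (n + 1) => ℝ) i).comp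
        (row i t) := by
      funext t
      ext w j
      simp [A, Finset.sum_apply, Pi.single_apply]
    rw [this]
    exact ContDiffOn.sum fun i _ => contDiffOn_const.clm_comp (hrow i)
  have hb : ContDiffOn ℝ ∞ b I := by
    refine contDiffOn_pi.2 fun i => ?_
    by_cases hi : i = Fin.last n
    · subst hi; simpa [b] using hh
    · simpa [b, Pi.single_apply, hi] using contDiffOn_const
  obtain ⟨v, hv⟩ := exists_solution_linearODE oI hI hne hA.continuousOn hb.continuousOn
  have hvs := contDiffOn_of_linearODE oI hA hb hv
  refine ⟨fun i t => v t i, contDiffOn_pi.1 hvs, fun i t ht => ?_, fun t ht => ?_⟩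
  · refine (hasDerivAt_pi.1 (hv t ht) i.castSucc).congr_deriv ?_
    simp [A, b, row, P, (Fin.castSucc_lt_last i).ne]
  · refine (hasDerivAt_pi.1 (hv t ht) (Fin.last n)).congr_deriv ?_
    simp [A, b, row, P]

/-- A monic linear ordinary differential equation in functions of `x` is solvable. -/
theorem exists_monic_solution (n : ℕ) (c : Fin (n + 1) → Fun F) (hc : ∀ i, OnlyX (c i))
    {h : Fun F} (hh : OnlyX h) :
    ∃ f : Fun F, OnlyX f ∧ (dx ^ (n + 1)) f = ∑ i : Fin (n + 1), c i * (dx ^ (i : ℕ)) f + h := by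
  obtain ⟨g, U, hU, oU, hne, hord, hg, hrep⟩ :=
    exists_common_repX (fun o : Option (Fin (n + 1)) => o.elim h c) (by rintro (_ | i); exacts [hh, hc i])
  obtain ⟨v, hv, hv1, hv2⟩ := exists_companion_solution (isOpenMap_fst U oU) hord
    (hne.image _) n (fun i => hg (some i)) (hg none)
  choose φ hφ hφr using fun i => exists_repX hU oU (hv i)
  have h1 : ∀ i : Fin n, dx (φ i.castSucc) = φ i.succ := fun i =>
    (RepX.dx hU (hφr _) (hv1 i)).eq hU (hφr _) fun _ _ => rfl
  have h2 : dx (φ (Fin.last n)) = ∑ i, c i * φ i + h :=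
    (RepX.dx hU (hφr _) hv2).eq hU
      ((RepX.sum _ fun i _ => (hrep (some i)).mul (hφr i)).add (hrep none)) fun _ _ => rfl
  have h3 : ∀ i : Fin (n + 1), (dx ^ (i : ℕ)) (φ 0) = φ i := by
    intro i
    induction i using Fin.induction with
    | zero => rfl
    | succ i ih =>
      rw [Fin.val_succ, pow_succ', end_mul_apply, ← h1, ← ih]
      rfl
  refine ⟨φ 0, hφ 0, ?_⟩
  rw [pow_succ', end_mul_apply]
  have h4 := h3 (Fin.last n)
  rw [Fin.val_last] at h4
  rw [h4, h2]
  simp only [h3]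

/-! ### Scalar operators: order, division, kernel and image. -/

theorem mulLeft_apply (a f : Fun F) : AddMonoid.End.mulLeft a f = a * f := rfl

theorem dx_mul_mulLeft (a : Fun F) :
    dx * AddMonoid.End.mulLeft a = AddMonoid.End.mulLeft a * dx + AddMonoid.End.mulLeft (dx a) :=
  AddMonoidHom.ext fun f => dx_mul a f

theorem mulLeft_mul (a b : Fun F) : AddMonoid.End.mulLeft (a * b) =
    AddMonoid.End.mulLeft a * AddMonoid.End.mulLeft b :=
  AddMonoidHom.ext fun f => mul_assoc a b f

theorem mulLeft_one : AddMonoid.End.mulLeft (1 : Fun F) = 1 :=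
  AddMonoidHom.ext fun f => one_mul f

section Order

variable {C : Subring (Fun F)}

/-- Operators of order less than `n` with coefficients in `C`. -/
def opLT (C : Subring (Fun F)) (n : ℕ) : Set (AddMonoid.End (Fun F)) :=
  {T | ∃ a : ℕ → Fun F, (∀ i, a i ∈ C) ∧
    T = ∑ i ∈ Finset.range n, AddMonoid.End.mulLeft (a i) * dx ^ i}

theorem mem_opLT_zero {T : AddMonoid.End (Fun F)} : T ∈ opLT C 0 ↔ T = 0 :=
  ⟨fun ⟨_, _, h⟩ => by simpa using h, fun h => ⟨0, fun _ => C.zero_mem, by simpa using h⟩⟩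

theorem mem_opLT_succ {T : AddMonoid.End (Fun F)} {n : ℕ} :
    T ∈ opLT C (n + 1) ↔ ∃ β ∈ C, T - AddMonoid.End.mulLeft β * dx ^ n ∈ opLT C n := by
  constructor
  · rintro ⟨a, ha, rfl⟩
    exact ⟨a n, ha n, a, ha, by rw [Finset.sum_range_succ, add_sub_cancel_right]⟩
  · rintro ⟨β, hβ, a, ha, h⟩
    refine ⟨Function.update a n β, fun i => ?_, ?_⟩
    · by_cases hi : i = n
      · subst hi; simpa using hβ
      · simpa [hi] using ha i
    · rw [Finset.sum_range_succ, Function.update_self, ← sub_eq_iff_eq_add, h]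
      refine Finset.sum_congr rfl fun i hi => ?_
      rw [Function.update_of_ne (Finset.mem_range.1 hi).ne]

theorem zero_mem_opLT (n : ℕ) : (0 : AddMonoid.End (Fun F)) ∈ opLT C n :=
  ⟨0, fun _ => C.zero_mem, by simp⟩

theorem add_mem_opLT {S T : AddMonoid.End (Fun F)} {n : ℕ} (hS : S ∈ opLT C n)
    (hT : T ∈ opLT C n) : S + T ∈ opLT C n := by
  obtain ⟨a, ha, rfl⟩ := hS
  obtain ⟨b, hb, rfl⟩ := hT
  exact ⟨a + b, fun i => C.add_mem (ha i) (hb i), by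
    simp [add_mul, Finset.sum_add_distrib]⟩

theorem mulLeft_mul_mem_opLT {T : AddMonoid.End (Fun F)} {n : ℕ} {c : Fun F} (hc : c ∈ C)
    (hT : T ∈ opLT C n) : AddMonoid.End.mulLeft c * T ∈ opLT C n := by
  obtain ⟨a, ha, rfl⟩ := hT
  exact ⟨fun i => c * a i, fun i => C.mul_mem hc (ha i), by
    simp [Finset.mul_sum, mulLeft_mul, mul_assoc]⟩

theorem neg_mem_opLT {T : AddMonoid.End (Fun F)} {n : ℕ} (hT : T ∈ opLT C n) :
    -T ∈ opLT C n := by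
  obtain ⟨a, ha, rfl⟩ := hT
  exact ⟨-a, fun i => C.neg_mem (ha i), by simp⟩

theorem opLT_mono {n m : ℕ} (h : n ≤ m) : opLT C n ⊆ opLT C m := by
  induction h with
  | refl => exact subset_rfl
  | step _ ih => exact ih.trans fun T hT => mem_opLT_succ.2 ⟨0, C.zero_mem, by simpa using hT⟩

/-- Leibniz on the top term: $D\,\beta D^n=\beta D^{n+1}+\beta' D^n$. -/
theorem dx_mul_mem_opLT (hC : ∀ f ∈ C, dx f ∈ C) {n : ℕ} :
    ∀ {T : AddMonoid.End (Fun F)}, T ∈ opLT C n → dx * T ∈ opLT C (n + 1) := by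
  induction n with
  | zero =>
    intro T hT
    rw [mem_opLT_zero.1 hT, mul_zero]
    exact zero_mem_opLT _
  | succ n ih =>
    intro T hT
    obtain ⟨β, hβ, h⟩ := mem_opLT_succ.1 hT
    refine mem_opLT_succ.2 ⟨β, hβ, ?_⟩
    have h1 : dx * T - AddMonoid.End.mulLeft β * dx ^ (n + 1) =
        dx * (T - AddMonoid.End.mulLeft β * dx ^ n) + AddMonoid.End.mulLeft (dx β) * dx ^ n := by
      rw [mul_sub, ← mul_assoc, dx_mul_mulLeft, pow_succ', add_mul]
      simp only [mul_assoc]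
      abel
    rw [h1]
    refine add_mem_opLT (ih h) (mem_opLT_succ.2 ⟨dx β, hC β hβ, ?_⟩)
    rw [sub_self]
    exact zero_mem_opLT _

theorem isLODO_iff {T : AddMonoid.End (Fun F)} :
    IsLODO (C : Set (Fun F)) T ↔ ∃ n, T ∈ opLT C n :=
  ⟨fun ⟨n, h⟩ => ⟨n + 1, h⟩, fun ⟨n, h⟩ => ⟨n, opLT_mono n.le_succ h⟩⟩

/-- Operators with coefficients in a differential ring form a ring. -/
def opRing (C : Subring (Fun F)) (hC : ∀ f ∈ C, dx f ∈ C) : Subring (AddMonoid.End (Fun F)) where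
  carrier := {T | IsLODO (C : Set (Fun F)) T}
  mul_mem' {S T} hS hT := by
    obtain ⟨n, a, ha, rfl⟩ := isLODO_iff.1 hS
    obtain ⟨m, hm⟩ := isLODO_iff.1 hT
    refine isLODO_iff.2 ⟨n + m, ?_⟩
    rw [Finset.sum_mul]
    have h : ∀ i, dx ^ i * T ∈ opLT C (i + m) := by
      intro i
      induction i with
      | zero => simpa using hm
      | succ i ih =>
        rw [pow_succ', mul_assoc, Nat.succ_add]
        exact dx_mul_mem_opLT hC ih
    refine Finset.sum_induction _ (· ∈ opLT C (n + m)) (fun _ _ => add_mem_opLT)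
      (zero_mem_opLT _) fun i hi => ?_
    rw [mul_assoc]
    exact mulLeft_mul_mem_opLT (ha i)
      (opLT_mono (Nat.add_le_add_right (Finset.mem_range.1 hi).le m) (h i))
  one_mem' := isLODO_iff.2 ⟨1, fun _ => 1, fun _ => C.one_mem, by simp [mulLeft_one]⟩
  add_mem' {S T} hS hT := by
    obtain ⟨n, hn⟩ := isLODO_iff.1 hS
    obtain ⟨m, hm⟩ := isLODO_iff.1 hT
    exact isLODO_iff.2 ⟨max n m, add_mem_opLT (opLT_mono (le_max_left _ _) hn)
      (opLT_mono (le_max_right _ _) hm)⟩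
  zero_mem' := isLODO_iff.2 ⟨0, zero_mem_opLT 0⟩
  neg_mem' {T} hT := by
    obtain ⟨n, hn⟩ := isLODO_iff.1 hT
    exact isLODO_iff.2 ⟨n, neg_mem_opLT hn⟩

/-- The least `n` such that `T` has order less than `n`. -/
noncomputable def opOrd (C : Subring (Fun F)) (T : AddMonoid.End (Fun F)) : ℕ :=
  sInf {n | T ∈ opLT C n}

theorem mem_opLT_opOrd {T : AddMonoid.End (Fun F)} (hT : IsLODO (C : Set (Fun F)) T) :
    T ∈ opLT C (opOrd C T) :=
  Nat.sInf_mem (s := {n | T ∈ opLT C n}) (isLODO_iff.1 hT)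

theorem opOrd_le {T : AddMonoid.End (Fun F)} {n : ℕ} (hT : T ∈ opLT C n) : opOrd C T ≤ n :=
  Nat.sInf_le hT

/-- `opOrd` is the order plus one, with value 0 for the zero operator. Its minimality forces the top
coefficient to be nonzero. -/
theorem exists_leading {T : AddMonoid.End (Fun F)} (hT : IsLODO (C : Set (Fun F)) T)
    (h0 : T ≠ 0) : ∃ m, opOrd C T = m + 1 ∧
      ∃ β ∈ C, β ≠ 0 ∧ T - AddMonoid.End.mulLeft β * dx ^ m ∈ opLT C m := by
  have h := mem_opLT_opOrd hT
  cases hm : opOrd C T with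
  | zero => rw [hm] at h; exact absurd (mem_opLT_zero.1 h) h0
  | succ m =>
    rw [hm] at h
    obtain ⟨β, hβ, hl⟩ := mem_opLT_succ.1 h
    refine ⟨m, rfl, β, hβ, ?_, hl⟩
    rintro rfl
    rw [map_zero, zero_mul, sub_zero] at hl
    have := opOrd_le hl
    omega

/-- Left multiplication by $D^j$ shifts the leading term and keeps its coefficient; the derivatives
of $\beta$ enter only in lower order. -/
theorem leading_dx_pow_mul (hC : ∀ f ∈ C, dx f ∈ C) {T : AddMonoid.End (Fun F)} {m : ℕ}
    {β : Fun F} (hβ : β ∈ C) (h : T - AddMonoid.End.mulLeft β * dx ^ m ∈ opLT C m) (j : ℕ) :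
    dx ^ j * T - AddMonoid.End.mulLeft β * dx ^ (m + j) ∈ opLT C (m + j) := by
  induction j with
  | zero => simpa using h
  | succ j ih =>
    have h1 : dx ^ (j + 1) * T - AddMonoid.End.mulLeft β * dx ^ (m + (j + 1)) =
        dx * (dx ^ j * T - AddMonoid.End.mulLeft β * dx ^ (m + j)) +
          AddMonoid.End.mulLeft (dx β) * dx ^ (m + j) := by
      rw [mul_sub, ← mul_assoc, ← mul_assoc, dx_mul_mulLeft, ← add_assoc m, pow_succ',
        pow_succ' _ (m + j), add_mul]
      simp only [mul_assoc]
      abel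
    rw [h1, ← add_assoc m]
    refine add_mem_opLT (dx_mul_mem_opLT hC ih) (mem_opLT_succ.2 ⟨dx β, hC β hβ, ?_⟩)
    rw [sub_self]
    exact zero_mem_opLT _

/-- One step of the division of operators. -/
theorem exists_opOrd_add_mul_lt (hC : ∀ f ∈ C, dx f ∈ C)
    (hinv : ∀ f ∈ C, f ≠ 0 → ∃ g ∈ C, f * g = 1) {S T : AddMonoid.End (Fun F)}
    (hS : IsLODO (C : Set (Fun F)) S) (hT : IsLODO (C : Set (Fun F)) T) (hS0 : S ≠ 0)
    (hT0 : T ≠ 0) (h : opOrd C T ≤ opOrd C S) :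
    ∃ Q, IsLODO (C : Set (Fun F)) Q ∧ opOrd C (S + Q * T) < opOrd C S := by
  obtain ⟨n, hn, α, hα, -, hSl⟩ := exists_leading hS hS0
  obtain ⟨m, hm, β, hβ, hβ0, hTl⟩ := exists_leading hT hT0
  obtain ⟨γ, hγ, hβγ⟩ := hinv β hβ hβ0
  obtain ⟨j, rfl⟩ : ∃ j, n = m + j := ⟨n - m, by omega⟩
  -- The quotient is $-(\alpha/\beta)D^{n-m}$, chosen to cancel the leading term $\alpha D^n$ of
  -- `S`.
  refine ⟨-(AddMonoid.End.mulLeft (α * γ) * dx ^ j), isLODO_iff.2 ⟨j + 1, neg_mem_opLT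
    (mem_opLT_succ.2 ⟨_, C.mul_mem hα hγ, by rw [sub_self]; exact zero_mem_opLT _⟩)⟩, ?_⟩
  rw [hn, Nat.lt_succ_iff]
  have h1 : S + -(AddMonoid.End.mulLeft (α * γ) * dx ^ j) * T =
      (S - AddMonoid.End.mulLeft α * dx ^ (m + j)) + -(AddMonoid.End.mulLeft (α * γ) *
        (dx ^ j * T - AddMonoid.End.mulLeft β * dx ^ (m + j))) := by
    have h2 : AddMonoid.End.mulLeft (α * γ) * AddMonoid.End.mulLeft β =
        AddMonoid.End.mulLeft α := by
      rw [← mulLeft_mul, mul_assoc, mul_comm γ, hβγ, mul_one]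
    rw [mul_sub, ← mul_assoc (AddMonoid.End.mulLeft (α * γ)) (AddMonoid.End.mulLeft β), h2,
      neg_mul, mul_assoc]
    abel
  rw [h1]
  exact opOrd_le (add_mem_opLT hSl
    (neg_mem_opLT (mulLeft_mul_mem_opLT (C.mul_mem hα hγ) (leading_dx_pow_mul hC hβ hTl j))))

/-- An operator that annihilates all functions of `x` is zero. -/
theorem eq_zero_of_forall_onlyX {T : AddMonoid.End (Fun F)} (hT : IsLODO (C : Set (Fun F)) T)
    (h : ∀ f, OnlyX f → T f = 0) : T = 0 := by
  obtain ⟨n, a, -, rfl⟩ := isLODO_iff.1 hT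
  obtain ⟨t, ht, t0, dt0, dt⟩ := exists_divided_powers F
  have h1 : ∀ i j, (dx ^ i) (t (i + j)) = t j := by
    intro i
    induction i with
    | zero => intro j; rw [Nat.zero_add]; rfl
    | succ i ih =>
      intro j
      rw [pow_succ, end_mul_apply, Nat.add_right_comm, dt, ih]
  have h2 : ∀ i j, j < i → (dx ^ i) (t j) = 0 := by
    intro i j hij
    obtain ⟨l, rfl⟩ := Nat.exists_eq_add_of_lt hij
    have h3 := h1 j 0
    rw [Nat.add_zero] at h3
    rw [show j + l + 1 = l + (1 + j) by ring, pow_add, pow_add, end_mul_apply, end_mul_apply, h3,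
      pow_one, dt0, map_zero]
  -- Testing on $t_j=x^j/j!$: terms with $i>j$ kill $t_j$, those with $i<j$ vanish by induction, and
  -- $D^jt_j=1$ leaves exactly $a_j$.
  have h3 : ∀ j, j < n → a j = 0 := by
    intro j
    induction j using Nat.strong_induction_on with
    | _ j ih =>
      intro hj
      have h4 := h (t j) (ht j)
      rw [end_sum_apply, Finset.sum_eq_single j] at h4
      · have h5 := h1 j 0
        rw [Nat.add_zero] at h5
        rwa [end_mul_apply, h5, t0, mulLeft_apply, mul_one] at h4
      · intro i hi hij
        rw [end_mul_apply]
        rcases lt_or_gt_of_ne hij with hlt | hgt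
        · rw [mulLeft_apply, ih i hlt (Finset.mem_range.1 hi), zero_mul]
        · rw [h2 i j hgt, map_zero]
      · intro hj'
        exact absurd (Finset.mem_range.2 hj) hj'
  refine Finset.sum_eq_zero fun i hi => ?_
  rw [h3 i (Finset.mem_range.1 hi), map_zero, zero_mul]

/-- A nonzero operator over a differential field of functions of `x` is onto the functions
of `x`. -/
theorem exists_onlyX_apply_eq (hX : ∀ f ∈ C, OnlyX f)
    (hinv : ∀ f ∈ C, f ≠ 0 → ∃ g ∈ C, f * g = 1) {T : AddMonoid.End (Fun F)}
    (hT : IsLODO (C : Set (Fun F)) T) (hT0 : T ≠ 0) {h : Fun F} (hh : OnlyX h) :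
    ∃ f, OnlyX f ∧ T f = h := by
  obtain ⟨m, -, β, hβ, hβ0, a, ha, hl⟩ := exists_leading hT hT0
  obtain ⟨γ, hγ, hβγ⟩ := hinv β hβ hβ0
  rw [sub_eq_iff_eq_add] at hl
  have hTf : ∀ f, T f = ∑ i ∈ Finset.range m, a i * (dx ^ i) f + β * (dx ^ m) f := by
    intro f
    rw [hl, end_add_apply, end_sum_apply]
    rfl
  cases m with
  | zero =>
    refine ⟨γ * h, (ringX F).mul_mem (hX γ hγ) hh, ?_⟩
    rw [hTf, Finset.range_zero, Finset.sum_empty, zero_add, pow_zero]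
    change β * (γ * h) = h
    rw [← mul_assoc, hβγ, one_mul]
  | succ n =>
    -- Division by the leading coefficient `β`, whose inverse is `γ`, makes the equation monic.
    obtain ⟨f, hf, he⟩ := exists_monic_solution n (fun i => -(γ * a i))
      (fun i => (ringX F).neg_mem ((ringX F).mul_mem (hX γ hγ) (hX _ (ha i))))
      (h := γ * h) ((ringX F).mul_mem (hX γ hγ) hh)
    refine ⟨f, hf, ?_⟩
    rw [hTf, he, Finset.sum_range, mul_add, ← mul_assoc β γ, hβγ, one_mul, ← add_assoc,
      Finset.mul_sum, ← Finset.sum_add_distrib, Finset.sum_eq_zero, zero_add]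
    intro i _
    linear_combination (-(a i * (dx ^ (i : ℕ)) f)) * hβγ

end Order

/-! ### Matrices of operators over $K_x$ and their echelon form. -/

namespace DiffField

variable (K : DiffField F)

/-- The elements of the differential field that depend on `x` only. -/
def subringX : Subring (Fun F) where
  carrier := {f | f ∈ K.toSubring ∧ OnlyX f}
  mul_mem' hf hg := ⟨K.toSubring.mul_mem hf.1 hg.1, (ringX F).mul_mem hf.2 hg.2⟩
  one_mem' := ⟨K.toSubring.one_mem, (ringX F).one_mem⟩
  add_mem' hf hg := ⟨K.toSubring.add_mem hf.1 hg.1, (ringX F).add_mem hf.2 hg.2⟩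
  zero_mem' := ⟨K.toSubring.zero_mem, (ringX F).zero_mem⟩
  neg_mem' hf := ⟨K.toSubring.neg_mem hf.1, (ringX F).neg_mem hf.2⟩

theorem dx_mem_subringX (f : Fun F) (hf : f ∈ K.subringX) : dx f ∈ K.subringX :=
  ⟨K.dx_mem f hf.1, hf.2.dx⟩

/-- Applying $\partial/\partial y$ to $fg=1$ gives $f\,\partial g/\partial y=0$, and $f$ is a unit.
Thus $K_x$ is a field. -/
theorem exists_inv_subringX (f : Fun F) (hf : f ∈ K.subringX) (h0 : f ≠ 0) :
    ∃ g ∈ K.subringX, f * g = 1 := by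
  obtain ⟨g, hg, h⟩ := K.exists_inv f hf.1 h0
  refine ⟨g, ⟨hg, onlyX_of_dy_eq_zero ?_⟩, h⟩
  have h1 := dy_mul f g
  rw [h, hf.2.dy_eq_zero, (show OnlyX (1 : Fun F) from (ringX F).one_mem).dy_eq_zero, zero_mul,
    add_zero] at h1
  linear_combination (-dy g) * h - g * h1

/-- The ring of operators with coefficients in the differential field. -/
def opXY : Subring (AddMonoid.End (Fun F)) := opRing K.toSubring K.dx_mem

/-- The ring of operators with coefficients that depend on `x` only. -/
def opX : Subring (AddMonoid.End (Fun F)) := opRing K.subringX K.dx_mem_subringX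

theorem mem_opXY {T : AddMonoid.End (Fun F)} : T ∈ K.opXY ↔ K.IsOp T := Iff.rfl

variable {K}

theorem IsOpX.isOp {T : AddMonoid.End (Fun F)} (hT : K.IsOpX T) : K.IsOp T := by
  obtain ⟨n, a, ha, h⟩ := hT
  exact ⟨n, a, fun i => (ha i).1, h⟩

theorem isOp_mulLeft {c : Fun F} (hc : c ∈ K.toSubring) :
    K.IsOp (AddMonoid.End.mulLeft c) :=
  ⟨0, fun _ => c, fun _ => hc, by simp⟩

theorem IsOpX.onlyX_apply {T : AddMonoid.End (Fun F)} (hT : K.IsOpX T) {f : Fun F}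
    (hf : OnlyX f) : OnlyX (T f) := by
  obtain ⟨n, a, ha, rfl⟩ := hT
  rw [end_sum_apply]
  refine (ringX F).sum_mem fun i _ => (ringX F).mul_mem (ha i).2 ?_
  clear * - hf
  change OnlyX ((dx ^ i) f)
  induction i with
  | zero => exact hf
  | succ i ih =>
    rw [pow_succ', end_mul_apply]
    exact ih.dx

theorem IsMatX.mul {l m n : ℕ} {R : Matrix (Fin l) (Fin m) (AddMonoid.End (Fun F))}
    {S : Matrix (Fin m) (Fin n) (AddMonoid.End (Fun F))} (hR : K.IsMatX R) (hS : K.IsMatX S) :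
    K.IsMatX (R * S) := fun i j => by
  rw [Matrix.mul_apply]
  exact K.opX.sum_mem fun c _ => K.opX.mul_mem (hR i c) (hS c j)

theorem IsMatX.one {n : ℕ} :
    K.IsMatX (1 : Matrix (Fin n) (Fin n) (AddMonoid.End (Fun F))) := fun i j => by
  rw [Matrix.one_apply]
  split_ifs
  exacts [K.opX.one_mem, K.opX.zero_mem]

theorem isOp_vecMul {m n : ℕ} {N : Fin m → AddMonoid.End (Fun F)}
    {S : Matrix (Fin m) (Fin n) (AddMonoid.End (Fun F))} (hN : ∀ i, K.IsOp (N i))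
    (hS : K.IsMatX S) (j : Fin n) : K.IsOp (Matrix.vecMul N S j) := by
  rw [← mem_opXY, Matrix.vecMul, dotProduct]
  exact K.opXY.sum_mem fun c _ => K.opXY.mul_mem (hN c) (hS c j).isOp

/-- Elementary row operations multiply by an invertible matrix on the left. -/
theorem RowStep.exists_eq_mul {m n : ℕ}
    {R R' : Matrix (Fin m) (Fin n) (AddMonoid.End (Fun F))} (h : K.RowStep R R') :
    ∃ T T' : Matrix (Fin m) (Fin m) (AddMonoid.End (Fun F)), K.IsMatX T ∧ K.IsMatX T' ∧
      T * T' = 1 ∧ T' * T = 1 ∧ R' = T * R := by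
  cases h with
  | swap i j =>
    have hmul : ∀ {n : ℕ} (S : Matrix (Fin m) (Fin n) (AddMonoid.End (Fun F))),
        (1 : Matrix (Fin m) (Fin m) (AddMonoid.End (Fun F))).submatrix (Equiv.swap i j) id * S =
          S.submatrix (Equiv.swap i j) id := by
      intro n S
      refine Matrix.ext fun r c => ?_
      simp [Matrix.mul_apply, Matrix.one_apply]
    have hsq : (1 : Matrix (Fin m) (Fin m) (AddMonoid.End (Fun F))).submatrix
        (Equiv.swap i j) id * (1 : Matrix (Fin m) (Fin m) (AddMonoid.End (Fun F))).submatrix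
        (Equiv.swap i j) id = 1 := by
      have h : ∀ r, Equiv.swap i j (Equiv.swap i j r) = r := by simp
      rw [hmul]
      refine Matrix.ext fun r c => ?_
      exact congrArg (fun x => (1 : Matrix (Fin m) (Fin m) (AddMonoid.End (Fun F))) x c) (h r)
    exact ⟨_, _, fun r c => IsMatX.one _ _, fun r c => IsMatX.one _ _, hsq, hsq, (hmul R).symm⟩
  | add i j hij T hT =>
    have hmat : ∀ T, K.IsOpX T → K.IsMatX
        (1 + Matrix.single i j T : Matrix (Fin m) (Fin m) (AddMonoid.End (Fun F))) := by
      intro T hT r c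
      refine K.opX.add_mem (IsMatX.one r c) ?_
      rw [Matrix.single_apply]
      split_ifs
      exacts [hT, K.opX.zero_mem]
    have hinv : ∀ T : AddMonoid.End (Fun F),
        (1 + Matrix.single i j T : Matrix (Fin m) (Fin m) (AddMonoid.End (Fun F))) *
          (1 + Matrix.single i j (-T)) = 1 := by
      intro T
      rw [mul_add, add_mul, add_mul, one_mul, mul_one, one_mul,
        Matrix.single_mul_single_of_ne _ _ _ _ hij.symm, add_zero, add_assoc,
        ← Matrix.single_add, add_neg_cancel, Matrix.single_zero, add_zero]
    refine ⟨1 + Matrix.single i j T, 1 + Matrix.single i j (-T), hmat T hT,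
      hmat _ (K.opX.neg_mem hT), hinv T, by simpa using hinv (-T), ?_⟩
    refine Matrix.ext fun r c => ?_
    rw [Matrix.add_mul, Matrix.one_mul, Matrix.add_apply]
    by_cases hr : r = i
    · subst hr
      rw [Matrix.updateRow_self, Matrix.single_mul_apply_same]
    · rw [Matrix.updateRow_ne hr, Matrix.single_mul_apply_of_ne _ _ _ _ _ hr, add_zero]

theorem exists_eq_mul_of_reflTransGen {m n : ℕ}
    {R R' : Matrix (Fin m) (Fin n) (AddMonoid.End (Fun F))}
    (h : Relation.ReflTransGen K.RowStep R R') :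
    ∃ T T' : Matrix (Fin m) (Fin m) (AddMonoid.End (Fun F)), K.IsMatX T ∧ K.IsMatX T' ∧
      T * T' = 1 ∧ T' * T = 1 ∧ R' = T * R := by
  induction h with
  | refl => exact ⟨1, 1, IsMatX.one, IsMatX.one, one_mul _, one_mul _, (Matrix.one_mul _).symm⟩
  | tail _ h ih =>
    obtain ⟨T, T', hT, hT', h1, h2, rfl⟩ := ih
    obtain ⟨S, S', hS, hS', h3, h4, rfl⟩ := h.exists_eq_mul
    refine ⟨S * T, T' * S', hS.mul hT, hT'.mul hS', ?_, ?_, (Matrix.mul_assoc _ _ _).symm⟩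
    · rw [Matrix.mul_assoc, ← Matrix.mul_assoc T, h1, Matrix.one_mul, h3]
    · rw [Matrix.mul_assoc, ← Matrix.mul_assoc S', h4, Matrix.one_mul, h2]

theorem RowStep.isMatX {m n : ℕ} {R R' : Matrix (Fin m) (Fin n) (AddMonoid.End (Fun F))}
    (h : K.RowStep R R') (hR : K.IsMatX R) : K.IsMatX R' := by
  obtain ⟨T, -, hT, -, -, -, rfl⟩ := h.exists_eq_mul
  exact hT.mul hR

/-- Row operations on the rows from `s` on clear the column `c` below the row `s`. -/
theorem exists_clear_column {m n : ℕ} (s : ℕ) (c : Fin n) :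
    ∀ (d : ℕ) (R : Matrix (Fin m) (Fin n) (AddMonoid.End (Fun F))), K.IsMatX R →
      ∑ i : Fin m, (if s ≤ i then opOrd K.subringX (R i c) else 0) = d →
      ∃ R', Relation.ReflTransGen K.RowStep R R' ∧ (∀ i : Fin m, (i : ℕ) < s → R' i = R i) ∧
        (∀ c', (∀ i : Fin m, s ≤ i → R i c' = 0) → ∀ i : Fin m, s ≤ i → R' i c' = 0) ∧
        ∀ i : Fin m, s < i → R' i c = 0 := by
  intro d
  -- Euclidean algorithm on the column, by induction on the sum of the orders of its entries from
  -- row `s` on. Two nonzero entries allow a division that lowers the sum; a single one is swapped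
  -- into row `s`.
  induction d using Nat.strong_induction_on with
  | _ d ih =>
    intro R hR hd
    by_cases hex : ∃ i j : Fin m, i ≠ j ∧ s ≤ i ∧ s ≤ j ∧ R i c ≠ 0 ∧ R j c ≠ 0 ∧
        opOrd K.subringX (R j c) ≤ opOrd K.subringX (R i c)
    · obtain ⟨i, j, hij, hi, hj, hi0, hj0, hle⟩ := hex
      obtain ⟨Q, hQ, hlt⟩ := exists_opOrd_add_mul_lt K.dx_mem_subringX K.exists_inv_subringX
        (hR i c) (hR j c) hi0 hj0 hle
      have hstep := RowStep.add (K := K) R i j hij Q hQ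
      obtain ⟨R', h1, h2, h3, h4⟩ := ih _ (by
        rw [← hd]
        refine Finset.sum_lt_sum (fun r _ => ?_) ⟨i, Finset.mem_univ i, ?_⟩
        · by_cases hr : r = i
          · subst hr
            rw [if_pos hi, if_pos hi, Matrix.updateRow_self]
            exact hlt.le
          · rw [Matrix.updateRow_ne hr]
        · rw [if_pos hi, if_pos hi, Matrix.updateRow_self]
          exact hlt) _ (hstep.isMatX hR) rfl
      refine ⟨R', .head hstep h1, fun r hr => ?_, fun c' hc' => h3 c' fun r hr => ?_, h4⟩
      · rw [h2 r hr]
        exact Matrix.updateRow_ne (by rintro rfl; omega)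
      · by_cases hri : r = i
        · subst hri
          rw [Matrix.updateRow_self, hc' _ hi, hc' _ hj, mul_zero, add_zero]
        · rw [Matrix.updateRow_ne hri, hc' r hr]
    · by_cases hz : ∃ i : Fin m, s ≤ i ∧ R i c ≠ 0
      · obtain ⟨i, hi, hi0⟩ := hz
        have hu : ∀ j : Fin m, s ≤ j → j ≠ i → R j c = 0 := by
          intro j hj hji
          by_contra hj0
          rcases le_total (opOrd K.subringX (R j c)) (opOrd K.subringX (R i c)) with h | h
          · exact hex ⟨i, j, hji.symm, hi, hj, hi0, hj0, h⟩
          · exact hex ⟨j, i, hji, hj, hi, hj0, hi0, h⟩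
        let s' : Fin m := ⟨s, hi.trans_lt i.2⟩
        refine ⟨_, .single (RowStep.swap R s' i), fun r hr => ?_, fun c' hc' r hr => ?_,
          fun r hr => ?_⟩
        · have : Equiv.swap s' i r = r := Equiv.swap_apply_of_ne_of_ne
            (by rintro rfl; exact lt_irrefl _ hr) (by rintro rfl; omega)
          funext c'
          rw [Matrix.submatrix_apply, this]
          rfl
        · rw [Matrix.submatrix_apply]
          refine hc' _ ?_
          rw [Equiv.swap_apply_def]
          split_ifs
          exacts [hi, le_rfl, hr]
        · rw [Matrix.submatrix_apply]
          by_cases hri : r = i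
          · subst hri
            rw [Equiv.swap_apply_right]
            exact hu _ le_rfl fun h => hr.ne (congrArg Fin.val h)
          · rw [Equiv.swap_apply_of_ne_of_ne (fun h => hr.ne' (congrArg Fin.val h)) hri]
            exact hu _ hr.le hri
      · push Not at hz
        exact ⟨R, .refl, fun _ _ => rfl, fun _ h => h, fun i hi => hz i hi.le⟩

/-- Every operator matrix can be brought to echelon form by row operations. -/
theorem exists_echelon {m n : ℕ} (R : Matrix (Fin m) (Fin n) (AddMonoid.End (Fun F)))
    (hR : K.IsMatX R) : ∃ A, Relation.ReflTransGen K.RowStep R A ∧ IsEchelon A := by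
  -- Invariant after `c` columns: `s` pivots are found, the rows from `s` on vanish in these
  -- columns, and each pivot row `i` has a nonzero entry in a column `c₀` such that later pivot rows
  -- vanish up to and including `c₀`.
  have key : ∀ c ≤ n, ∃ A, Relation.ReflTransGen K.RowStep R A ∧ ∃ s : ℕ,
      (∀ i : Fin m, s ≤ i → ∀ c' : Fin n, (c' : ℕ) < c → A i c' = 0) ∧
      ∀ i : Fin m, (i : ℕ) < s → ∃ c₀ : Fin n, (c₀ : ℕ) < c ∧ A i c₀ ≠ 0 ∧
        ∀ i' : Fin m, i < i' → (i' : ℕ) < s → ∀ c' ≤ c₀, A i' c' = 0 := by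
    intro c hc
    induction c with
    | zero => exact ⟨R, .refl, 0, fun _ _ _ h => absurd h (by omega), fun _ h => absurd h (by omega)⟩
    | succ c ih =>
      obtain ⟨A, hA, s, ha, hb⟩ := ih (by omega)
      obtain ⟨T, -, hT, -, -, -, hTR⟩ := exists_eq_mul_of_reflTransGen hA
      obtain ⟨B, hB, h1, h2, h3⟩ := exists_clear_column s ⟨c, hc⟩ _ A (hTR ▸ hT.mul hR) rfl
      have hb' : ∀ i : Fin m, (i : ℕ) < s → ∃ c₀ : Fin n, (c₀ : ℕ) < c ∧ B i c₀ ≠ 0 ∧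
          ∀ i' : Fin m, i < i' → ∀ c' ≤ c₀, B i' c' = 0 := by
        intro i hi
        obtain ⟨c₀, hc₀, hne, hz⟩ := hb i hi
        refine ⟨c₀, hc₀, by rwa [h1 i hi], fun i' hi' c' hc' => ?_⟩
        rcases lt_or_ge (i' : ℕ) s with hs | hs
        · rw [h1 i' hs]
          exact hz i' hi' hs c' hc'
        · exact h2 c' (fun r hr => ha r hr c' (lt_of_le_of_lt hc' hc₀)) i' hs
      -- A nonzero entry of row `s` in column `c` is a new pivot; otherwise the column is zero from
      -- row `s` on and `s` stays.
      by_cases hp : ∃ i : Fin m, (i : ℕ) = s ∧ B i ⟨c, hc⟩ ≠ 0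
      · obtain ⟨p, hps, hp0⟩ := hp
        refine ⟨B, hA.trans hB, s + 1, fun i hi c' hc' => ?_, fun i hi => ?_⟩
        · rcases Nat.lt_succ_iff_lt_or_eq.1 hc' with h | h
          · exact h2 c' (fun r hr => ha r hr c' h) i (by omega)
          · rw [show c' = ⟨c, hc⟩ from Fin.ext h]
            exact h3 i (by omega)
        · rcases Nat.lt_succ_iff_lt_or_eq.1 hi with h | h
          · obtain ⟨c₀, hc₀, hne, hz⟩ := hb' i h
            exact ⟨c₀, by omega, hne, fun i' hi' _ => hz i' hi'⟩
          · obtain rfl : i = p := Fin.ext (h.trans hps.symm)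
            refine ⟨⟨c, hc⟩, Nat.lt_succ_self c, hp0, fun i' hi' hs' => ?_⟩
            have : (i : ℕ) < i' := hi'
            omega
      · push Not at hp
        refine ⟨B, hA.trans hB, s, fun i hi c' hc' => ?_, fun i hi => ?_⟩
        · rcases Nat.lt_succ_iff_lt_or_eq.1 hc' with h | h
          · exact h2 c' (fun r hr => ha r hr c' h) i hi
          · rw [show c' = ⟨c, hc⟩ from Fin.ext h]
            rcases hi.eq_or_lt with hs | hs
            · exact hp i hs.symm
            · exact h3 i hs
        · obtain ⟨c₀, hc₀, hne, hz⟩ := hb' i hi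
          exact ⟨c₀, by omega, hne, fun i' hi' _ => hz i' hi'⟩
  obtain ⟨A, hA, s, ha, hb⟩ := key n le_rfl
  refine ⟨A, hA, fun i i' hii' c' hc' => ?_⟩
  have hs' : (i' : ℕ) < s := by
    by_contra h
    exact hc' (ha i' (not_lt.1 h) c' c'.2)
  have hlt : (i : ℕ) < i' := hii'
  obtain ⟨c₀, -, hne, hz⟩ := hb i (by omega)
  exact ⟨c₀, lt_of_not_ge fun h => hc' (hz i' hii' hs' c' h), hne⟩

end DiffField

/-! ### Action on columns of functions; full rank as surjectivity. -/

/-- First nonzero entries advance by at least one column per row. Hence an echelon matrix has no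
more nonzero rows than columns. -/
theorem IsEchelon.le_of_ne_zero {m n : ℕ} {A : Matrix (Fin m) (Fin n) (AddMonoid.End (Fun F))}
    (hA : IsEchelon A) (r : ℕ) : ∀ i : Fin m, (i : ℕ) = r → ∀ c, A i c ≠ 0 → r ≤ c := by
  induction r with
  | zero => exact fun _ _ _ _ => Nat.zero_le _
  | succ r ih =>
    intro i hi c hc
    obtain ⟨c', hlt, hne⟩ := hA ⟨r, by omega⟩ i (by rw [Fin.lt_def]; simp [hi]) c hc
    have := ih _ rfl c' hne
    have : (c' : ℕ) < c := hlt
    omega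

/-- The action of an operator matrix on columns of functions. -/
def matApply {m n : ℕ} (R : Matrix (Fin m) (Fin n) (AddMonoid.End (Fun F))) (φ : Fin n → Fun F) :
    Fin m → Fun F := fun i => ∑ j, R i j (φ j)

theorem matApply_mul {l m n : ℕ} (R : Matrix (Fin l) (Fin m) (AddMonoid.End (Fun F)))
    (S : Matrix (Fin m) (Fin n) (AddMonoid.End (Fun F))) (φ : Fin n → Fun F) :
    matApply (R * S) φ = matApply R (matApply S φ) := by
  funext i
  simp only [matApply, Matrix.mul_apply, end_sum_apply, end_mul_apply, map_sum]
  exact Finset.sum_comm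

theorem sum_vecMul_apply {m n : ℕ} (N : Fin m → AddMonoid.End (Fun F))
    (S : Matrix (Fin m) (Fin n) (AddMonoid.End (Fun F))) (φ : Fin n → Fun F) :
    ∑ j, Matrix.vecMul N S j (φ j) = ∑ i, N i (matApply S φ i) := by
  simp only [matApply, Matrix.vecMul, dotProduct, end_sum_apply, end_mul_apply, map_sum]
  exact Finset.sum_comm

theorem matApply_one {n : ℕ} (φ : Fin n → Fun F) :
    matApply (1 : Matrix (Fin n) (Fin n) (AddMonoid.End (Fun F))) φ = φ := by
  funext i
  rw [matApply, Finset.sum_eq_single i]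
  · rw [Matrix.one_apply_eq]; rfl
  · intro j _ hj
    rw [Matrix.one_apply_ne hj.symm]; rfl
  · simp

theorem onlyX_matApply {K : DiffField F} {m n : ℕ}
    {R : Matrix (Fin m) (Fin n) (AddMonoid.End (Fun F))} (hR : K.IsMatX R) {φ : Fin n → Fun F}
    (hφ : ∀ j, OnlyX (φ j)) (i : Fin m) : OnlyX (matApply R φ i) :=
  (ringX F).sum_mem fun j _ => (hR i j).onlyX_apply (hφ j)

/-- The operator matrix maps the columns of functions of `x` onto the columns of functions
of `x`. -/
def OntoX {m n : ℕ} (R : Matrix (Fin m) (Fin n) (AddMonoid.End (Fun F))) : Prop :=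
  ∀ ψ : Fin m → Fun F, (∀ i, OnlyX (ψ i)) → ∃ φ : Fin n → Fun F,
    (∀ j, OnlyX (φ j)) ∧ matApply R φ = ψ

theorem OntoX.mul_left {K : DiffField F} {m n : ℕ}
    {R : Matrix (Fin m) (Fin n) (AddMonoid.End (Fun F))} (hR : OntoX R)
    {T T' : Matrix (Fin m) (Fin m) (AddMonoid.End (Fun F))} (hT' : K.IsMatX T')
    (h : T * T' = 1) : OntoX (T * R) := by
  intro ψ hψ
  obtain ⟨φ, hφ, he⟩ := hR (matApply T' ψ) (onlyX_matApply hT' hψ)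
  exact ⟨φ, hφ, by rw [matApply_mul, he, ← matApply_mul, h, matApply_one]⟩

/-- An echelon matrix without zero rows is onto: back substitution. -/
theorem IsEchelon.ontoX {K : DiffField F} {m n : ℕ}
    {A : Matrix (Fin m) (Fin n) (AddMonoid.End (Fun F))} (hA : IsEchelon A) (hX : K.IsMatX A)
    (h0 : ∀ i, A i ≠ 0) : OntoX A := by
  intro ψ hψ
  have key : ∀ d ≤ m, ∃ φ : Fin n → Fun F, (∀ j, OnlyX (φ j)) ∧
      ∀ i : Fin m, m - d ≤ i → matApply A φ i = ψ i := by
    intro d hd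
    induction d with
    | zero => exact ⟨0, fun _ => (ringX F).zero_mem, fun i hi => absurd i.2 (by omega)⟩
    | succ d ih =>
      obtain ⟨φ, hφ, he⟩ := ih (by omega)
      let r : Fin m := ⟨m - (d + 1), by omega⟩
      obtain ⟨c, hc, hmin⟩ : ∃ c, A r c ≠ 0 ∧ ∀ c' < c, A r c' = 0 := by
        obtain ⟨c₁, hc₁⟩ := Function.ne_iff.1 (h0 r)
        obtain ⟨c, hc, hmin⟩ := WellFounded.has_min (wellFounded_lt (α := Fin n))
          {c | A r c ≠ 0} ⟨c₁, hc₁⟩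
        exact ⟨c, hc, fun c' hc' => by_contra fun h => hmin c' h hc'⟩
      -- With the rows below `r` already solved, `z` corrects the unknown at the pivot `c` of row
      -- `r`. Lower rows vanish in column `c`, so their equations are undisturbed.
      obtain ⟨z, hz, hze⟩ := exists_onlyX_apply_eq (C := K.subringX) (fun f hf => hf.2)
        K.exists_inv_subringX (hX r c) hc (h := ψ r - matApply A φ r)
        ((ringX F).sub_mem (hψ r) (onlyX_matApply hX hφ r))
      have hadd : ∀ i, matApply A (φ + Pi.single c z) i = matApply A φ i + A i c z := by
        intro i
        simp only [matApply, Pi.add_apply, map_add, Finset.sum_add_distrib]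
        congr 1
        rw [Finset.sum_eq_single c]
        · rw [Pi.single_eq_same]
        · intro j _ hj
          rw [Pi.single_eq_of_ne hj, map_zero]
        · simp
      refine ⟨φ + Pi.single c z, fun j => (ringX F).add_mem (hφ j) ?_, fun i hi => ?_⟩
      · by_cases hj : j = c
        · subst hj; rwa [Pi.single_eq_same]
        · rw [Pi.single_eq_of_ne hj]; exact (ringX F).zero_mem
      · rw [hadd]
        by_cases hir : i = r
        · subst hir
          rw [hze, add_sub_cancel]
        · have hri : r < i := lt_of_le_of_ne hi (Ne.symm hir)
          have hz0 : A i c = 0 := by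
            by_contra h
            obtain ⟨c', hlt, hne⟩ := hA r i hri c h
            exact hne (hmin c' hlt)
          rw [hz0, he i (by have : m - (d + 1) < (i : ℕ) := hri; omega)]
          exact add_zero _
  obtain ⟨φ, hφ, he⟩ := key m le_rfl
  exact ⟨φ, hφ, funext fun i => he i (by omega)⟩

/-- A matrix of operators has full row rank if and only if it is onto. -/
theorem hasRank_iff_ontoX {K : DiffField F} {m n : ℕ}
    {R : Matrix (Fin m) (Fin n) (AddMonoid.End (Fun F))} (hR : K.IsMatX R) :
    K.HasRank R m ↔ OntoX R := by
  constructor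
  · rintro ⟨A, hRA, hA, hcard⟩
    obtain ⟨T, T', hT, hT', h1, h2, rfl⟩ := DiffField.exists_eq_mul_of_reflTransGen hRA
    have huniv : {i | (T * R) i ≠ 0} = Set.univ := by
      refine Set.eq_of_subset_of_ncard_le (Set.subset_univ _) ?_ Set.finite_univ
      rw [hcard, Set.ncard_univ, Nat.card_eq_fintype_card, Fintype.card_fin]
    have h := (hA.ontoX (hT.mul hR) fun i => (huniv ▸ Set.mem_univ i : i ∈ {i | (T * R) i ≠ 0}))
    have h3 := h.mul_left hT h2
    rwa [← Matrix.mul_assoc, h2, Matrix.one_mul] at h3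
  · intro h
    obtain ⟨A, hRA, hA⟩ := DiffField.exists_echelon R hR
    refine ⟨A, hRA, hA, ?_⟩
    obtain ⟨T, T', hT, hT', h1, h2, rfl⟩ := DiffField.exists_eq_mul_of_reflTransGen hRA
    have h3 : OntoX (T * R) := h.mul_left hT' h1
    have huniv : {i | (T * R) i ≠ 0} = Set.univ := by
      refine Set.eq_univ_of_forall fun i hi => ?_
      -- A zero row cannot reach the constant 1.
      obtain ⟨φ, -, he⟩ := h3 (fun _ => 1) fun _ => (ringX F).one_mem
      have h4 := congrFun he i
      rw [matApply, Finset.sum_eq_zero fun j _ => by rw [hi]; rfl] at h4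
      have := F.neBot
      exact zero_ne_one (congrArg Subtype.val h4 : (0 : Filter.Germ F.toFilter ℝ) = 1)
    rw [huniv, Set.ncard_univ, Nat.card_eq_fintype_card, Fintype.card_fin]

/-! ### Independence over functions of $x$, common left factors, and left inverses. -/

theorem exists_linearIndependent_span {k V ι : Type*} [Field k] [AddCommGroup V] [Module k V]
    [Finite ι] (a : ι → V) : ∃ (N : ℕ) (e : Fin N → V),
      (∀ α, e α ∈ Submodule.span k (Set.range a)) ∧ LinearIndependent k e ∧
      ∃ c : ι → Fin N → k, ∀ i, a i = ∑ α, c i α • e α := by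
  have := Module.Finite.span_of_finite k (Set.finite_range a)
  let b := Module.finBasis k (Submodule.span k (Set.range a))
  refine ⟨_, fun α => (b α : V), fun α => (b α).2,
    b.linearIndependent.map' (Submodule.subtype _) (Submodule.ker_subtype _),
    fun i => b.repr ⟨a i, Submodule.subset_span ⟨i, rfl⟩⟩, fun i => ?_⟩
  have h := congrArg Subtype.val (b.sum_repr ⟨a i, Submodule.subset_span ⟨i, rfl⟩⟩)
  rw [Submodule.coe_sum] at h
  exact h.symm

namespace DiffField

variable {K : DiffField F}

/-- Elements of the differential field which are independent over its elements depending on `x`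
only are independent over all functions of `x`. -/
theorem onlyX_independent : ∀ (N : ℕ) (e : Fin N → Fun F), (∀ α, e α ∈ K.toSubring) →
    (∀ c : Fin N → Fun F, (∀ α, c α ∈ K.subringX) → ∑ α, c α * e α = 0 → ∀ α, c α = 0) →
    ∀ g : Fin N → Fun F, (∀ α, OnlyX (g α)) → ∑ α, g α * e α = 0 → ∀ α, g α = 0 := by
  intro N
  induction N with
  | zero => exact fun _ _ _ _ _ _ α => α.elim0
  | succ N ih =>
    intro e he hind g hg hsum
    have he0 : e 0 ≠ 0 := by
      intro h0
      have h1 := hind (Pi.single 0 1) (fun α => by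
        by_cases hα : α = 0
        · subst hα; rw [Pi.single_eq_same]; exact K.subringX.one_mem
        · rw [Pi.single_eq_of_ne hα]; exact K.subringX.zero_mem) (by
        rw [Fin.sum_univ_succ, Pi.single_eq_same, h0, mul_zero, zero_add]
        exact Finset.sum_eq_zero fun α _ => by
          rw [Pi.single_eq_of_ne (Fin.succ_ne_zero α), zero_mul]) 0
      rw [Pi.single_eq_same] at h1
      have := F.neBot
      exact one_ne_zero (congrArg Subtype.val h1 : (1 : Filter.Germ F.toFilter ℝ) = 0)
    -- Dividing a relation by `e 0` and applying $\partial/\partial y$, for which functions of $x$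
    -- are constants, leaves a relation among the $N$ functions $\partial_y(e_{\alpha+1}/e_0)$.
    obtain ⟨u, hu, heu⟩ := K.exists_inv _ (he 0) he0
    have hdy : ∀ c : Fin N → Fun F, (∀ α, OnlyX (c α)) →
        dy (∑ α, c α * (e α.succ * u)) = ∑ α, c α * dy (e α.succ * u) := by
      intro c hc
      rw [map_sum]
      exact Finset.sum_congr rfl fun α _ => by
        rw [dy_mul, (hc α).dy_eq_zero, zero_mul, add_zero]
    have hmul : ∀ c : Fin N → Fun F,
        ∑ α, c α * (e α.succ * u) = (∑ α, c α * e α.succ) * u := by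
      intro c
      rw [Finset.sum_mul]
      exact Finset.sum_congr rfl fun α _ => (mul_assoc _ _ _).symm
    rw [Fin.sum_univ_succ] at hsum
    have hsum' : g 0 = -∑ α : Fin N, g α.succ * (e α.succ * u) := by
      rw [hmul fun α => g α.succ]
      linear_combination u * hsum - g 0 * heu
    have hg' : ∀ α : Fin N, g α.succ = 0 := by
      refine ih (fun α => dy (e α.succ * u))
        (fun α => K.dy_mem _ (K.toSubring.mul_mem (he _) hu)) (fun c hc hcs => ?_)
        (fun α => g α.succ) (fun α => hg _) ?_
      -- The derivatives inherit independence over $K_x$: a relation among them makes $\sum c_\alpha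
      -- e_{\alpha+1}/e_0$ an element of $K$ free of $y$, so of $K_x$, and this is a relation among
      -- the original `e α`.
      · have hX : OnlyX (∑ α, c α * (e α.succ * u)) :=
          onlyX_of_dy_eq_zero ((hdy c fun α => (hc α).2).trans hcs)
        have hK : ∑ α, c α * (e α.succ * u) ∈ K.toSubring := K.toSubring.sum_mem fun α _ =>
          K.toSubring.mul_mem (hc α).1 (K.toSubring.mul_mem (he _) hu)
        have h1 := hind (Fin.cons (-∑ α, c α * (e α.succ * u)) c)
          (fun α => Fin.cases (K.subringX.neg_mem ⟨hK, hX⟩) hc α) (by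
            rw [Fin.sum_univ_succ]
            simp only [Fin.cons_zero, Fin.cons_succ]
            rw [hmul]
            linear_combination (-∑ α, c α * e α.succ) * heu)
        exact fun α => h1 α.succ
      · rw [← hdy _ fun α => hg _, ← neg_eq_iff_eq_neg.2 hsum', map_neg, (hg 0).dy_eq_zero,
          neg_zero]
    refine fun α => Fin.cases ?_ hg' α
    rw [hsum', Finset.sum_eq_zero fun α _ => by rw [hg', zero_mul], neg_zero]

/-- Linear algebra over the field $K_x$. The basis lies in the span of the `a i`, hence in $K$. -/
theorem exists_finite_basis {ι : Type*} [Finite ι] (a : ι → Fun F)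
    (ha : ∀ i, a i ∈ K.toSubring) : ∃ (N : ℕ) (e : Fin N → Fun F), (∀ α, e α ∈ K.toSubring) ∧
      (∀ c : Fin N → Fun F, (∀ α, c α ∈ K.subringX) → ∑ α, c α * e α = 0 → ∀ α, c α = 0) ∧
      ∃ c : ι → Fin N → Fun F, (∀ i α, c i α ∈ K.subringX) ∧ ∀ i, a i = ∑ α, c i α * e α := by
  have hF : IsField K.subringX := by
    have := F.neBot
    refine ⟨⟨0, 1, fun h => ?_⟩, mul_comm, fun {f} hf => ?_⟩
    · exact zero_ne_one (congrArg (fun f : K.subringX => (f : Fun F).1) h :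
        (0 : Filter.Germ F.toFilter ℝ) = 1)
    · obtain ⟨g, hg, h⟩ := K.exists_inv_subringX f f.2 fun h => hf (Subtype.ext h)
      exact ⟨⟨g, hg⟩, Subtype.ext h⟩
  obtain ⟨N, e, he, hind, c, hc⟩ :=
    @exists_linearIndependent_span K.subringX (Fun F) ι hF.toField _ _ _ a
  refine ⟨N, e, fun α => ?_, fun c hc hs α => ?_, fun i α => c i α, fun i α => (c i α).2, hc⟩
  · refine Submodule.span_induction (p := fun v _ => v ∈ K.toSubring) ?_ K.toSubring.zero_mem
      (fun _ _ _ _ => K.toSubring.add_mem)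
      (fun (c : K.subringX) _ _ => K.toSubring.mul_mem c.2.1) (he α)
    rintro _ ⟨i, rfl⟩
    exact ha i
  · exact congrArg Subtype.val (Fintype.linearIndependent_iff.1 hind
      (fun α => (⟨c α, hc α⟩ : K.subringX)) hs α)

/-- Finitely many operators `L(x, y)` are combinations of operators `Q(x)`, with multipliers
from the differential field that are independent over the functions of `x`. -/
theorem exists_common_factor {ι : Type*} [Finite ι] (T : ι → AddMonoid.End (Fun F))
    (hT : ∀ j, K.IsOp (T j)) : ∃ (N : ℕ) (e : Fin N → Fun F), (∀ α, e α ∈ K.toSubring) ∧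
      (∀ g : Fin N → Fun F, (∀ α, OnlyX (g α)) → ∑ α, g α * e α = 0 → ∀ α, g α = 0) ∧
      ∃ Q : Fin N → ι → AddMonoid.End (Fun F), (∀ α j, K.IsOpX (Q α j)) ∧
        ∀ j, T j = ∑ α, AddMonoid.End.mulLeft (e α) * Q α j := by
  choose n a ha hTa using hT
  obtain ⟨N, e, he, hind, c, hc, hac⟩ := K.exists_finite_basis
    (fun s : Σ j, Fin (n j + 1) => a s.1 s.2) fun s => ha _ _
  refine ⟨N, e, he, onlyX_independent N e he hind,
    fun α j => ∑ i : Fin (n j + 1), AddMonoid.End.mulLeft (c ⟨j, i⟩ α) * dx ^ (i : ℕ),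
    fun α j => K.opX.sum_mem fun i _ => isLODO_iff.2 ⟨i + 1, mem_opLT_succ.2
      ⟨_, hc _ _, by rw [sub_self]; exact zero_mem_opLT _⟩⟩, fun j => ?_⟩
  rw [hTa j, Finset.sum_range]
  simp only [Finset.mul_sum]
  rw [Finset.sum_comm]
  refine Finset.sum_congr rfl fun i _ => ?_
  rw [hac ⟨j, i⟩, map_sum, Finset.sum_mul]
  refine Finset.sum_congr rfl fun α _ => ?_
  rw [mul_comm (c _ _), mulLeft_mul, mul_assoc]

/-- If `M̄ = N̄ Q̂(x)` is operator-irreducible, then `Q̂(x)` has a left inverse. -/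
theorem exists_left_inverse_of_irreducible {p q : ℕ} {M : Fin p → AddMonoid.End (Fun F)}
    (hirr : ¬ K.OperatorReducible M) {E : Fin q → AddMonoid.End (Fun F)} (hE : ∀ i, K.IsOp (E i))
    {Q : Matrix (Fin q) (Fin p) (AddMonoid.End (Fun F))} (hQ : K.IsMatX Q)
    (hM : M = Matrix.vecMul E Q) :
    ∃ S : Matrix (Fin p) (Fin q) (AddMonoid.End (Fun F)), K.IsMatX S ∧ S * Q = 1 := by
  rcases le_total q p with hqp | hpq
  · by_contra h
    exact hirr ⟨q, hqp, E, Q, hE, hQ, fun ⟨S, hS, _, h2⟩ => h ⟨S, hS, h2⟩, hM⟩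
  -- If `Q` has too many rows for the definition of reducibility, its echelon form `T * Q` is zero
  -- from row `p` on. Its upper $p\times p$ block also factors `M`, so irreducibility makes this
  -- block invertible.
  · obtain ⟨A, hQA, hA⟩ := exists_echelon Q hQ
    obtain ⟨T, T', hT, hT', h1, h2, rfl⟩ := exists_eq_mul_of_reflTransGen hQA
    have hTQ := hT.mul hQ
    let ι : Fin p → Fin q := Fin.castLE hpq
    have hzero : ∀ (i : Fin q) (c : Fin p), p ≤ i → (T * Q) i c = 0 := by
      intro i c hi
      by_contra h
      have := hA.le_of_ne_zero i i rfl c h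
      omega
    have hsum : ∀ f : Fin q → AddMonoid.End (Fun F), (∀ i : Fin q, p ≤ i → f i = 0) →
        ∑ i, f i = ∑ i, f (ι i) := by
      intro f hf
      refine (Finset.sum_of_injOn ι (Fin.castLE_injective hpq).injOn (fun _ _ => Finset.mem_univ _)
        (fun i _ hi => hf i ?_) fun _ _ => rfl).symm
      by_contra hlt
      exact hi ⟨⟨i, not_le.1 hlt⟩, by simp, rfl⟩
    by_contra h
    refine hirr ⟨p, le_rfl, fun i => Matrix.vecMul E T' (ι i), (T * Q).submatrix ι id,
      fun i => isOp_vecMul hE hT' _, fun i c => hTQ _ _, fun ⟨S, hS, _, h4⟩ => h ?_, ?_⟩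
    -- The inverse of the block times the first `p` rows of `T` is a left inverse of `Q`.
    · refine ⟨S * T.submatrix ι id, hS.mul fun i c => hT _ _, ?_⟩
      rw [Matrix.mul_assoc, ← h4]
      rfl
    · have hM' : M = Matrix.vecMul (Matrix.vecMul E T') (T * Q) := by
        rw [Matrix.vecMul_vecMul, ← Matrix.mul_assoc, h2, Matrix.one_mul, hM]
      rw [hM']
      funext c
      rw [Matrix.vecMul, dotProduct, hsum _ fun i hi => by rw [hzero i c hi, mul_zero]]
      rfl

end DiffField

end Euler

/-! ### The factorization and the rank criterion. -/

theorem mainTheorem5 (F : Euler.DomainFilter) (K : Euler.DiffField F) (p k : ℕ)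
    (M : Fin p → AddMonoid.End (Euler.Fun F)) (L : Fin k → AddMonoid.End (Euler.Fun F))
    (hM : ∀ i, K.IsOp (M i)) (hL : ∀ j, K.IsOp (L j))
    (hirr : ¬ K.OperatorReducible M) (hsub : Euler.stock L ⊆ Euler.stock M) :
    (∃ R : Matrix (Fin p) (Fin k) (AddMonoid.End (Euler.Fun F)),
      K.IsMatX R ∧ L = Matrix.vecMul M R) ∧
    ∀ R : Matrix (Fin p) (Fin k) (AddMonoid.End (Euler.Fun F)),
      K.IsMatX R → L = Matrix.vecMul M R →
        (K.HasRank R p ↔ Euler.stock M = Euler.stock L) := by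
  open Euler Euler.DiffField in
  obtain ⟨N, e, he, hind, W, hW, hML⟩ := K.exists_common_factor (Sum.elim M L)
    (by rintro (i | j); exacts [hM i, hL j])
  let E : Fin N → AddMonoid.End (Fun F) := fun α => AddMonoid.End.mulLeft (e α)
  let Q : Matrix (Fin N) (Fin p) (AddMonoid.End (Fun F)) := fun α i => W α (Sum.inl i)
  let P : Matrix (Fin N) (Fin k) (AddMonoid.End (Fun F)) := fun α j => W α (Sum.inr j)
  have hQ : K.IsMatX Q := fun α i => hW _ _
  have hP : K.IsMatX P := fun α i => hW _ _
  have hMQ : M = Matrix.vecMul E Q := funext fun i => hML (Sum.inl i)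
  have hLP : L = Matrix.vecMul E P := funext fun j => hML (Sum.inr j)
  obtain ⟨S, hS, hSQ⟩ := exists_left_inverse_of_irreducible hirr
    (fun α => isOp_mulLeft (he α)) hQ hMQ
  have hEinj : ∀ g g' : Fin N → Fun F, (∀ α, OnlyX (g α)) → (∀ α, OnlyX (g' α)) →
      ∑ α, E α (g α) = ∑ α, E α (g' α) → g = g' := by
    intro g g' hg hg' h
    funext α
    refine sub_eq_zero.1 (hind (fun α => g α - g' α)
      (fun α => (ringX F).sub_mem (hg α) (hg' α)) ?_ α)
    rw [← sub_eq_zero, ← Finset.sum_sub_distrib] at h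
    rw [← h]
    refine Finset.sum_congr rfl fun α _ => ?_
    change (g α - g' α) * e α = e α * g α - e α * g' α
    ring
  have hMinj : ∀ ψ ψ' : Fin p → Fun F, (∀ i, OnlyX (ψ i)) → (∀ i, OnlyX (ψ' i)) →
      ∑ i, M i (ψ i) = ∑ i, M i (ψ' i) → ψ = ψ' := by
    intro ψ ψ' hψ hψ' h
    rw [hMQ, sum_vecMul_apply, sum_vecMul_apply] at h
    have h1 := congrArg (matApply S)
      (hEinj _ _ (onlyX_matApply hQ hψ) (onlyX_matApply hQ hψ') h)
    rwa [← matApply_mul, ← matApply_mul, hSQ, matApply_one, matApply_one] at h1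
  refine ⟨⟨S * P, hS.mul hP, ?_⟩, fun R hR hLR => ?_⟩
  -- The inclusion of stocks puts every `P φ` in the image of `Q`, on which `Q * S` acts as the
  -- identity.
  · have hQSP : P = Q * (S * P) := by
      have hmat := hQ.mul (hS.mul hP)
      have happ : ∀ φ : Fin k → Fun F, (∀ j, OnlyX (φ j)) →
          matApply P φ = matApply (Q * (S * P)) φ := by
        intro φ hφ
        obtain ⟨ψ, hψ, h⟩ := hsub ⟨φ, hφ, rfl⟩
        rw [hMQ, hLP, sum_vecMul_apply, sum_vecMul_apply] at h
        have h1 := hEinj _ _ (onlyX_matApply hP hφ) (onlyX_matApply hQ hψ) h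
        rw [matApply_mul, matApply_mul, h1, ← matApply_mul S, hSQ, matApply_one]
      refine Matrix.ext fun α j => sub_eq_zero.1 ?_
      refine eq_zero_of_forall_onlyX (C := K.subringX)
        (K.opX.sub_mem (hP α j) (hmat α j)) fun f hf => ?_
      have hsingle : ∀ (B : Matrix (Fin N) (Fin k) (AddMonoid.End (Fun F))),
          matApply B (Pi.single j f) α = B α j f := by
        intro B
        rw [matApply, Finset.sum_eq_single j]
        · rw [Pi.single_eq_same]
        · intro i _ hi
          rw [Pi.single_eq_of_ne hi, map_zero]
        · simp
      have h1 := congrFun (happ (Pi.single j f) fun i => by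
        by_cases hi : i = j
        · subst hi; rwa [Pi.single_eq_same]
        · rw [Pi.single_eq_of_ne hi]; exact (ringX F).zero_mem) α
      rw [hsingle, hsingle] at h1
      exact sub_eq_zero.2 h1
    rw [hMQ, Matrix.vecMul_vecMul, ← hQSP, hLP]
  · rw [hasRank_iff_ontoX hR]
    constructor
    · refine fun h => Set.Subset.antisymm ?_ hsub
      rintro f ⟨ψ, hψ, rfl⟩
      obtain ⟨φ, hφ, rfl⟩ := h ψ hψ
      exact ⟨φ, hφ, by rw [hLR, sum_vecMul_apply]⟩
    · intro h ψ hψ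
      -- Equality of stocks gives $\overline M\psi=\overline M\widehat R\varphi$; injectivity of
      -- $\overline M$ then gives $\psi=\widehat R\varphi$.
      obtain ⟨φ, hφ, he⟩ : ∑ i, M i (ψ i) ∈ stock L := h ▸ ⟨ψ, hψ, rfl⟩
      rw [hLR, sum_vecMul_apply] at he
      exact ⟨φ, hφ, (hMinj _ _ hψ (onlyX_matApply hR hφ) he).symm⟩
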